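/- Fix integers $r,d\ge 1$. Let $G_0$ be a finite hypergraph (hyperedges are multisets of vertices, and $\deg(v)$ counts occurrences of $v$ in all hyperedges) whose vertices are partitioned into communities $C_0^{(1)},\dots,C_0^{(r)}$, each containing a vertex of positive degree (for instance $r$ disjoint hyperedges of cardinality $1$ lying in different communities). Let $p\in(0,1)$, $\gamma>0$, let $M=(m_1,\dots,m_r)$ be a probability vector with all $m_j>0$, and let $P=(P_{i_1,\dots,i_d})$ be an array of nonnegative numbers such that $P_{i_1,\dots,i_d}$ depends only on the set $\{i_1,\dots,i_d\}\subseteq\{1,\dots,r\}$ and is the probability that exactly these communities share a new hyperedge (summed over the different sets, these probabilities give $1$). Let $X_t=(X_t^{(1)},\dots,X_t^{(r)})$, $t\ge 0$, be independent random vectors of positive integers (also independent of all other choices below; the coordinates of one vector may be dependent). The random hypergraph $G_{t+1}$ arises from $G_t$ as follows. With probability $p$, one new isolated vertex is added, and it joins community $j$ with probability $m_j$. Otherwise a new hyperedge is created: a set of communities is drawn according to $P$; each selected community $i$ is assigned an index $j_i$ chosen independently and uniformly from $\{1,\dots,r\}$; from each selected community $i$, $X_t^{(j_i)}$ vertices are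 drawn independently with repetition, $u\in C_t^{(i)}$ being drawn with probability $(\deg_t(u)+\gamma)/\sum_{v\in C_t^{(i)}}(\deg_t(v)+\gamma)$; all drawn vertices form the new hyperedge. Assume that ${\mathbb E}[X_t^{(i)}]=\mu_i<\infty$ and $X_t^{(i)}\ge 1$ for all $t$ and $i$, and that $X_t^{(i)}<t^{1/4}$ for all $i$ and all sufficiently large $t$. Let $s_j$ be the probability that community $j$ is among those sharing a newly created hyperedge, let $\bar V_j$ be the expected number of vertices added to $C_t^{(j)}$ in a single time step, and let $\bar D_j$ be the expected number of vertices of $C_t^{(j)}$, counted with multiplicity, that increase their degree in a single time step. Then, for every time step, $\bar V_j=pm_j$ and $\bar D_j=(1-p)s_j\frac{\mu_1+\dots+\mu_r}{r}$, and the degree distribution of $G_t$ follows a power law with exponent $$\beta=2+\gamma\min_{1\le j\le r}\frac{\bar V_j}{\bar D_j}=2+\frac{\gamma p}{(1-p)\frac{\mu_1+\dots+\mu_r}{r}}\cdot\min_{1\le j\le r}\frac{m_j}{s_j}\qquad(x/0=\infty \text{ for } x>0).$$ That is, with $N_{k,t}$ the number of vertices of degree $k$ in $G_t$ and $|V_t|$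 the number of vertices, the limit $L_k=\lim_{t\to\infty}{\mathbb E}[N_{k,t}/|V_t|]$ exists for every $k\ge 0$, and there is a constant $c>0$ such that $L_k/(c\,k^{-\beta})\to 1$ as $k\to\infty$. -/

import Mathlib

open Filter Topology
open scoped ENNReal NNReal

noncomputable section

/-- A finite hypergraph whose vertices `0, …, size - 1` are partitioned into `r` communities.
A hyperedge is a multiset of vertices (a vertex may be repeated) and hyperedges may be repeated.
Every community contains a vertex of positive degree, so that choosing a vertex of a community
in proportion to degrees is always meaningful. -/
structure CommunityHypergraph (r : ℕ) where
  size : ℕ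
  comm : Fin size → Fin r
  edges : Multiset (Multiset (Fin size))
  covered : ∀ j, ∃ v, comm v = j ∧ 0 < (edges.map (Multiset.count v)).sum

namespace CommunityHypergraph

variable {r : ℕ}

/-- The degree of a vertex: its number of occurrences in all hyperedges. -/
def degree (G : CommunityHypergraph r) (v : Fin G.size) : ℕ :=
  (G.edges.map (Multiset.count v)).sum

/-- The number of vertices of degree `k`. -/
def numDegree (G : CommunityHypergraph r) (k : ℕ) : ℕ :=
  (Finset.univ.filter fun v => G.degree v = k).card

/-- The number of vertices of community `j`. -/
def commSize (G : CommunityHypergraph r) (j : Fin r) : ℕ :=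
  (Finset.univ.filter fun v => G.comm v = j).card

/-- The sum of the degrees of the vertices of community `j`. -/
def commVolume (G : CommunityHypergraph r) (j : Fin r) : ℕ :=
  ∑ v ∈ Finset.univ.filter (fun v => G.comm v = j), G.degree v

/-- `r` disjoint hyperedges of cardinality one, whose vertices lie in different communities. -/
def singletons (r : ℕ) : CommunityHypergraph r where
  size := r
  comm := id
  edges := Finset.univ.val.map fun v => {v}
  covered := fun j => ⟨j, rfl, by
    have h : ({j} : Multiset (Fin r)) ∈ Finset.univ.val.map fun v : Fin r => ({v} : Multiset (Fin r)) :=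
      Multiset.mem_map_of_mem _ (Finset.mem_univ j)
    have := Multiset.single_le_sum (fun _ _ => Nat.zero_le _) _
      (Multiset.mem_map_of_mem (Multiset.count j) h)
    simp only [Multiset.count_singleton_self] at this
    exact this⟩

instance : Inhabited (CommunityHypergraph r) := ⟨singletons r⟩

/-- Add one new isolated vertex to community `i`. -/
def addVertex (G : CommunityHypergraph r) (i : Fin r) : CommunityHypergraph r where
  size := G.size + 1
  comm := Fin.snoc (α := fun _ => Fin r) G.comm i
  edges := G.edges.map (Multiset.map Fin.castSucc)
  covered := fun j => by
    obtain ⟨v, hv, hd⟩ := G.covered j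
    refine ⟨v.castSucc, by simpa using hv, ?_⟩
    have h : (Multiset.count v.castSucc ∘ Multiset.map Fin.castSucc) =
        Multiset.count (α := Fin G.size) v := by
      funext e
      exact Multiset.count_map_eq_count' _ _ (Fin.castSucc_injective _) _
    rw [Multiset.map_map, h]
    exact hd

/-- Add the hyperedge `e`. -/
def addEdge (G : CommunityHypergraph r) (e : Multiset (Fin G.size)) : CommunityHypergraph r where
  size := G.size
  comm := G.comm
  edges := e ::ₘ G.edges
  covered := fun j => by
    obtain ⟨v, hv, hd⟩ := G.covered j
    refine ⟨v, hv, ?_⟩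
    rw [Multiset.map_cons, Multiset.sum_cons]
    omega

/-- The weight with which a vertex is chosen from community `i`: `deg v + γ` inside the
community and `0` outside. -/
def weight (G : CommunityHypergraph r) (γ : ℝ≥0) (i : Fin r) (v : Fin G.size) : ℝ≥0∞ :=
  if G.comm v = i then (G.degree v : ℝ≥0∞) + γ else 0

theorem tsum_weight_ne_zero (G : CommunityHypergraph r) (γ : ℝ≥0) (i : Fin r) :
    ∑' v, G.weight γ i v ≠ 0 := by
  obtain ⟨v, hv, hd⟩ := G.covered i
  intro h
  have hw := ENNReal.tsum_eq_zero.mp h v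
  rw [weight, if_pos hv, add_eq_zero, Nat.cast_eq_zero] at hw
  exact hd.ne' hw.1

theorem tsum_weight_ne_top (G : CommunityHypergraph r) (γ : ℝ≥0) (i : Fin r) :
    ∑' v, G.weight γ i v ≠ ∞ := by
  rw [tsum_fintype]
  refine (ENNReal.sum_lt_top.mpr fun v _ => ?_).ne
  unfold weight
  split_ifs
  · exact ENNReal.add_lt_top.mpr ⟨ENNReal.natCast_lt_top _, ENNReal.coe_lt_top⟩
  · exact ENNReal.zero_lt_top

/-- A vertex of community `i` chosen in proportion to degrees:
`v` is chosen with probability `(deg v + γ) / ∑ u ∈ C i, (deg u + γ)`. -/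
def choose (G : CommunityHypergraph r) (γ : ℝ≥0) (i : Fin r) : PMF (Fin G.size) :=
  PMF.normalize (G.weight γ i) (G.tsum_weight_ne_zero γ i) (G.tsum_weight_ne_top γ i)

end CommunityHypergraph

/-- The multiset of `k` independent samples (with repetitions) of `q`. -/
def PMF.iidMultiset {α : Type} (q : PMF α) : ℕ → PMF (Multiset α)
  | 0 => PMF.pure 0
  | k + 1 => q.bind fun a => (q.iidMultiset k).map fun e => a ::ₘ e

/-- The union (with multiplicities) of independent samples, one of `f i` for each `i` in a list. -/
def PMF.indepUnion {ι α : Type} (f : ι → PMF (Multiset α)) : List ι → PMF (Multiset α)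
  | [] => PMF.pure 0
  | i :: l => (f i).bind fun e => (PMF.indepUnion f l).map fun e' => e + e'

/-- The expectation of a nonnegative function. -/
def PMF.mean {α : Type} (q : PMF α) (f : α → ℝ≥0∞) : ℝ≥0∞ := ∑' a, q a * f a

/-- The `d`-dimensional array of hyperedge probabilities over `r` communities. An entry depends
only on the set of communities that its index lists, and the probability of that set is stored
at every index listing it. -/
structure HyperedgeMatrix (r d : ℕ) where
  entry : (Fin d → Fin r) → ℝ≥0∞
  entry_eq : ∀ a b, Finset.univ.image a = Finset.univ.image b → entry a = entry b
  /-- The probabilities of the different sets of communities sum up to one. -/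
  sum_eq_one : ∑ S : Finset (Fin r), (⨆ a, ⨆ _ : Finset.univ.image a = S, entry a) = 1

namespace HyperedgeMatrix

variable {r d : ℕ}

/-- The probability that a new hyperedge is shared by exactly the communities in `S`: the common
value of the entries whose index lists `S` (and `0` if there is none). -/
def setProb (P : HyperedgeMatrix r d) (S : Finset (Fin r)) : ℝ≥0∞ :=
  ⨆ a, ⨆ _ : Finset.univ.image a = S, P.entry a

/-- The random set of communities sharing a new hyperedge. -/
def toPMF (P : HyperedgeMatrix r d) : PMF (Finset (Fin r)) :=
  PMF.ofFintype P.setProb P.sum_eq_one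

/-- The probability that community `j` is among those sharing a new hyperedge. -/
def share (P : HyperedgeMatrix r d) (j : Fin r) : ℝ≥0∞ :=
  ∑ S ∈ Finset.univ.filter (fun S => j ∈ S), P.toPMF S

end HyperedgeMatrix

/-- The parameters of the preferential attachment hypergraph with `r` communities. -/
structure CommunityModel (r d : ℕ) where
  /-- the initial hypergraph -/
  G₀ : CommunityHypergraph r
  /-- the probability of a vertex-step -/
  p : ℝ≥0
  p_pos : 0 < p
  p_lt_one : p < 1
  /-- the distribution of the community of a new vertex -/
  M : PMF (Fin r)
  M_pos : ∀ j, 0 < M j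
  /-- the hyperedge probabilities -/
  P : HyperedgeMatrix r d
  /-- `X t` is the joint law of the cardinalities `X_t^(1), …, X_t^(r)` -/
  X : ℕ → PMF (Fin r → ℕ)
  γ : ℝ≥0

namespace CommunityModel

variable {r d : ℕ} [NeZero r]

/-- A hyperedge built on `G` when the set `S` of communities has been selected and the
cardinalities are `x`: each community `i ∈ S` is independently assigned a uniform index `j`, and
then `x j` vertices of community `i` are chosen independently in proportion to degrees. -/
def newEdge (A : CommunityModel r d) (G : CommunityHypergraph r) (S : Finset (Fin r))
    (x : Fin r → ℕ) : PMF (Multiset (Fin G.size)) :=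
  PMF.indepUnion
    (fun i => (PMF.uniformOfFintype (Fin r)).bind fun j => (G.choose A.γ i).iidMultiset (x j))
    ((List.finRange r).filter fun i => i ∈ S)

/-- The law of the hypergraph at time `t + 1`, given the hypergraph `G` at time `t`. -/
def step (A : CommunityModel r d) (t : ℕ) (G : CommunityHypergraph r) :
    PMF (CommunityHypergraph r) :=
  (PMF.bernoulli A.p A.p_lt_one.le).bind fun isVertexStep =>
    if isVertexStep then A.M.map G.addVertex
    else A.P.toPMF.bind fun S => (A.X t).bind fun x => (A.newEdge G S x).map G.addEdge

/-- The law of the hypergraph at time `t`. -/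
def law (A : CommunityModel r d) : ℕ → PMF (CommunityHypergraph r)
  | 0 => PMF.pure A.G₀
  | t + 1 => (A.law t).bind (A.step t)

/-- The expected number of vertices added to community `j` in the step from `t` to `t + 1`. -/
def meanNewVertices (A : CommunityModel r d) (t : ℕ) (j : Fin r) : ℝ≥0∞ :=
  (A.law t).mean fun G => (A.step t G).mean fun G' => ((G'.commSize j - G.commSize j : ℕ) : ℝ≥0∞)

/-- The expected number of vertices of community `j`, counted with multiplicity, that increase
their degree in the step from `t` to `t + 1`. -/
def meanDegreeIncrease (A : CommunityModel r d) (t : ℕ) (j : Fin r) : ℝ≥0∞ :=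
  (A.law t).mean fun G =>
    (A.step t G).mean fun G' => ((G'.commVolume j - G.commVolume j : ℕ) : ℝ≥0∞)

/-- The expected fraction of vertices of degree `k` at time `t`. -/
def meanDegreeFraction (A : CommunityModel r d) (t k : ℕ) : ℝ :=
  ((A.law t).mean fun G => (G.numDegree k : ℝ≥0∞) / (G.size : ℝ≥0∞)).toReal

/-- The degree distribution follows a power law with exponent `β`: for every `k` the expected
fraction of vertices of degree `k` has a limit `L k` as `t → ∞`, and `L k ∼ c * k ^ (-β)` as
`k → ∞` for some positive constant `c`. -/
def FollowsPowerLaw (A : CommunityModel r d) (β : ℝ) : Prop :=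
  1 ≤ β ∧ ∃ L : ℕ → ℝ, (∀ k, Tendsto (fun t => A.meanDegreeFraction t k) atTop (𝓝 (L k))) ∧
    ∃ c : ℝ, 0 < c ∧ Tendsto (fun k : ℕ => L k / (c * (k : ℝ) ^ (-β))) atTop (𝓝 1)

end CommunityModel

end

/-! The communities can be analysed one at a time. The law of the pair (vertices added, degree
gained) in community `j` during one step does not depend on the current hypergraph (`map_step`). So
its size and volume drift at constant rates `V` (`vertexRate`) and `D` (`degreeRate`), and its total
weight, volume plus `γ` times size, has rate `κ = D + γ V`.

The weight is close to `κ t` in mean (`tendsto_expect_abs_functional_sub`). Second moments may be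
infinite at early times, where the sizes are only known to have a finite mean. The potential is
therefore the smoothed absolute value `√(M² + y²)`, which grows only linearly and whose drift under
a centred increment `z` is at most `z² / (2 M)`. Once the sizes are below `t^(1/4)`, the choice `M =
t^(3/4)` gives a mean deviation of order `t^(3/4)`.

Given the hypergraph, the multiplicity of a vertex in a sample is binomial. To first order the
number `N_k` of vertices of degree `k` in community `j` changes on average by `V` if `k = 0`, plus
`D / weight` times `(k - 1 + γ) N_{k-1} - (k + γ) N_k` (the first term absent for `k = 0`); see
`abs_expect_step_commDegree_sub_le`. Replacing the weight by `κ t` leaves a linear recurrence with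
error `o(1)`, which `tendsto_div_of_recurrence` solves. Induction on `k` gives `E[N_k] / t →
degreeLimit`, with `θ = D / κ`.

For `θ > 0` the sequence `degreeLimit` is a ratio of products of Gamma type, and Euler's limit
formula gives decay of order `k^(-(1 + 1/θ))`, where `1 + 1/θ = 2 + γ V / D`
(`exists_tendsto_degreeLimit`, `exists_tendsto_commLimit`). If `D = 0`, all terms of positive index
vanish. Since the number of vertices is close to `p t`, the limiting fractions are the sums over the
communities divided by `p`, and the slowest decay, that is the smallest `V / D`, determines the
exponent. -/

noncomputable section

/-! ### Expectations under discrete laws -/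

namespace PMF

variable {α β : Type}

theorem toReal_mul_eq (q : PMF α) (f : α → ℝ) (hf : ∀ a, 0 ≤ f a) (a : α) :
    (q a).toReal * f a = (q a * ENNReal.ofReal (f a)).toReal := by
  rw [ENNReal.toReal_mul, ENNReal.toReal_ofReal (hf a)]

theorem mean_bind (q : PMF α) (k : α → PMF β) (f : β → ℝ≥0∞) :
    (q.bind k).mean f = q.mean fun a => (k a).mean f := by
  simp only [mean, bind_apply, ← ENNReal.tsum_mul_right, ← ENNReal.tsum_mul_left]
  rw [ENNReal.tsum_comm]
  simp only [mul_assoc]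

theorem mean_pure (a : α) (f : α → ℝ≥0∞) : (PMF.pure a).mean f = f a := by
  classical
  rw [mean, tsum_eq_single a]
  · simp
  · intro b hb
    simp [pure_apply, hb]

theorem mean_map (q : PMF α) (g : α → β) (f : β → ℝ≥0∞) :
    (q.map g).mean f = q.mean fun a => f (g a) := by
  simp only [map, mean_bind, Function.comp_apply, mean_pure]

theorem mean_mono {q : PMF α} {f g : α → ℝ≥0∞} (h : ∀ a ∈ q.support, f a ≤ g a) :
    q.mean f ≤ q.mean g := by
  refine ENNReal.tsum_le_tsum fun a => ?_
  by_cases ha : q a = 0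
  · simp [ha]
  · exact mul_le_mul_right (h a ((mem_support_iff _ _).2 ha)) _

theorem mean_congr {q : PMF α} {f g : α → ℝ≥0∞} (h : ∀ a ∈ q.support, f a = g a) :
    q.mean f = q.mean g :=
  le_antisymm (mean_mono fun a ha => (h a ha).le) (mean_mono fun a ha => (h a ha).ge)

theorem mean_const (q : PMF α) (c : ℝ≥0∞) : (q.mean fun _ => c) = c := by
  rw [mean, ENNReal.tsum_mul_right, q.tsum_coe, one_mul]

theorem mean_add (q : PMF α) (f g : α → ℝ≥0∞) :
    (q.mean fun a => f a + g a) = q.mean f + q.mean g := by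
  simp only [mean, mul_add, ENNReal.tsum_add]

theorem mean_const_mul (q : PMF α) (c : ℝ≥0∞) (f : α → ℝ≥0∞) :
    (q.mean fun a => c * f a) = c * q.mean f := by
  simp only [mean, ← ENNReal.tsum_mul_left, mul_left_comm]

theorem mean_fintype [Fintype α] (q : PMF α) (f : α → ℝ≥0∞) : q.mean f = ∑ a, q a * f a := by
  rw [mean, tsum_fintype]

/-- The real function `f` has a finite expectation. -/
def HasExpect (q : PMF α) (f : α → ℝ) : Prop := Summable fun a => (q a).toReal * f a

/-- The expectation of a real function. -/
def expect (q : PMF α) (f : α → ℝ) : ℝ := ∑' a, (q a).toReal * f a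

/-- Integrability is moved to `ℝ≥0∞`, where sums can be exchanged freely. -/
theorem hasExpect_iff (q : PMF α) (f : α → ℝ) :
    q.HasExpect f ↔ (q.mean fun a => ENNReal.ofReal |f a|) ≠ ∞ := by
  unfold HasExpect mean
  rw [← summable_abs_iff]
  have e : ∀ a, |(q a).toReal * f a| = (q a * ENNReal.ofReal |f a|).toReal := fun a => by
    rw [ENNReal.toReal_mul, ENNReal.toReal_ofReal (abs_nonneg _), abs_mul,
      abs_of_nonneg ENNReal.toReal_nonneg]
  simp only [e]
  constructor
  · intro h
    have := h.tsum_ofReal_ne_top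
    refine ne_of_eq_of_ne (tsum_congr fun a => ?_) this
    rw [ENNReal.ofReal_toReal (ENNReal.mul_ne_top (q.apply_ne_top a) ENNReal.ofReal_ne_top)]
  · exact ENNReal.summable_toReal

theorem expect_of_nonneg (q : PMF α) {f : α → ℝ} (hf : ∀ a, 0 ≤ f a) :
    q.expect f = (q.mean fun a => ENNReal.ofReal (f a)).toReal := by
  unfold expect mean
  rw [ENNReal.tsum_toReal_eq fun a =>
    ENNReal.mul_ne_top (q.apply_ne_top a) ENNReal.ofReal_ne_top]
  exact tsum_congr fun a => q.toReal_mul_eq f hf a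

theorem HasExpect.mono {q : PMF α} {f g : α → ℝ} (hg : q.HasExpect g)
    (h : ∀ a ∈ q.support, |f a| ≤ g a) : q.HasExpect f := by
  rw [hasExpect_iff] at *
  refine ne_top_of_le_ne_top hg (mean_mono fun a ha => ENNReal.ofReal_le_ofReal ?_)
  exact (h a ha).trans (le_abs_self _)

theorem hasExpect_const (q : PMF α) (c : ℝ) : q.HasExpect fun _ => c := by
  rw [hasExpect_iff, mean_const]
  exact ENNReal.ofReal_ne_top

theorem hasExpect_of_bounded {q : PMF α} {f : α → ℝ} (C : ℝ) (h : ∀ a ∈ q.support, |f a| ≤ C) :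
    q.HasExpect f :=
  (q.hasExpect_const C).mono h

theorem HasExpect.add {q : PMF α} {f g : α → ℝ} (hf : q.HasExpect f) (hg : q.HasExpect g) :
    q.HasExpect fun a => f a + g a := by
  simpa only [HasExpect, mul_add] using Summable.add hf hg

theorem HasExpect.const_mul {q : PMF α} {f : α → ℝ} (hf : q.HasExpect f) (c : ℝ) :
    q.HasExpect fun a => c * f a := by
  simpa only [HasExpect, mul_left_comm] using Summable.mul_left c hf

theorem HasExpect.neg {q : PMF α} {f : α → ℝ} (hf : q.HasExpect f) :
    q.HasExpect fun a => - f a := by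
  simpa only [HasExpect, mul_neg] using Summable.neg hf

theorem HasExpect.sub {q : PMF α} {f g : α → ℝ} (hf : q.HasExpect f) (hg : q.HasExpect g) :
    q.HasExpect fun a => f a - g a := by
  simpa only [sub_eq_add_neg] using hf.add hg.neg

theorem HasExpect.abs {q : PMF α} {f : α → ℝ} (hf : q.HasExpect f) :
    q.HasExpect fun a => |f a| := by
  rw [hasExpect_iff] at *
  simpa only [abs_abs] using hf

theorem HasExpect.sum {ι : Type} {q : PMF α} (s : Finset ι) {f : ι → α → ℝ}
    (hf : ∀ i ∈ s, q.HasExpect (f i)) : q.HasExpect fun a => ∑ i ∈ s, f i a := by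
  simpa only [HasExpect, Finset.mul_sum] using summable_sum fun i hi => hf i hi

theorem expect_const (q : PMF α) (c : ℝ) : (q.expect fun _ => c) = c := by
  have h : ∑' a, (q a).toReal = 1 := by
    rw [← ENNReal.tsum_toReal_eq fun a => q.apply_ne_top a, q.tsum_coe, ENNReal.toReal_one]
  rw [expect, tsum_mul_right, h, one_mul]

theorem expect_add {q : PMF α} {f g : α → ℝ} (hf : q.HasExpect f) (hg : q.HasExpect g) :
    (q.expect fun a => f a + g a) = q.expect f + q.expect g := by
  simp only [expect, mul_add]
  exact Summable.tsum_add hf hg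

theorem expect_const_mul (q : PMF α) (c : ℝ) (f : α → ℝ) :
    (q.expect fun a => c * f a) = c * q.expect f := by
  simp only [expect, ← tsum_mul_left, mul_left_comm]

theorem expect_neg (q : PMF α) (f : α → ℝ) : (q.expect fun a => - f a) = - q.expect f := by
  simp only [expect, mul_neg, tsum_neg]

theorem expect_sub {q : PMF α} {f g : α → ℝ} (hf : q.HasExpect f) (hg : q.HasExpect g) :
    (q.expect fun a => f a - g a) = q.expect f - q.expect g := by
  simp only [sub_eq_add_neg]
  rw [expect_add hf hg.neg, expect_neg]

theorem expect_sum {ι : Type} {q : PMF α} (s : Finset ι) {f : ι → α → ℝ}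
    (hf : ∀ i ∈ s, q.HasExpect (f i)) :
    (q.expect fun a => ∑ i ∈ s, f i a) = ∑ i ∈ s, q.expect (f i) := by
  simp only [expect, Finset.mul_sum]
  exact Summable.tsum_finsetSum fun i hi => hf i hi

theorem expect_mono {q : PMF α} {f g : α → ℝ} (hf : q.HasExpect f) (hg : q.HasExpect g)
    (h : ∀ a ∈ q.support, f a ≤ g a) : q.expect f ≤ q.expect g := by
  refine Summable.tsum_le_tsum (fun a => ?_) hf hg
  by_cases ha : q a = 0
  · simp [ha]
  · exact mul_le_mul_of_nonneg_left (h a ((mem_support_iff _ _).2 ha)) ENNReal.toReal_nonneg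

theorem expect_congr {q : PMF α} {f g : α → ℝ} (h : ∀ a ∈ q.support, f a = g a) :
    q.expect f = q.expect g := by
  refine tsum_congr fun a => ?_
  by_cases ha : q a = 0
  · simp [ha]
  · rw [h a ((mem_support_iff _ _).2 ha)]

theorem HasExpect.congr {q : PMF α} {f g : α → ℝ} (hf : q.HasExpect f)
    (h : ∀ a ∈ q.support, f a = g a) : q.HasExpect g := by
  refine (summable_congr fun a => ?_).mp hf
  by_cases ha : q a = 0
  · simp [ha]
  · rw [h a ((mem_support_iff _ _).2 ha)]

theorem expect_nonneg {q : PMF α} {f : α → ℝ} (h : ∀ a ∈ q.support, 0 ≤ f a) :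
    0 ≤ q.expect f := by
  refine tsum_nonneg fun a => ?_
  by_cases ha : q a = 0
  · simp [ha]
  · exact mul_nonneg ENNReal.toReal_nonneg (h a ((mem_support_iff _ _).2 ha))

theorem abs_expect_le {q : PMF α} {f : α → ℝ} (hf : q.HasExpect f) :
    |q.expect f| ≤ q.expect fun a => |f a| := by
  rw [abs_le]
  constructor
  · rw [← expect_neg]
    exact expect_mono hf.abs.neg hf fun a _ => neg_abs_le _
  · exact expect_mono hf hf.abs fun a _ => le_abs_self _

theorem abs_expect_sub_le {q : PMF α} {f g e : α → ℝ} (hf : q.HasExpect f) (hg : q.HasExpect g)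
    (he : q.HasExpect e) (h : ∀ a ∈ q.support, |f a - g a| ≤ e a) :
    |q.expect f - q.expect g| ≤ q.expect e := by
  rw [← expect_sub hf hg]
  exact (abs_expect_le (hf.sub hg)).trans (expect_mono (hf.sub hg).abs he h)

/-- An infinite inner mean at a point of positive mass would make the total mean infinite. -/
theorem hasExpect_of_mem_support_bind {q : PMF α} {k : α → PMF β} {f : β → ℝ}
    (hf : (q.bind k).HasExpect f) {a : α} (ha : a ∈ q.support) : (k a).HasExpect f := by
  rw [hasExpect_iff] at *
  rw [mean_bind, mean] at hf
  intro h
  refine ENNReal.ne_top_of_tsum_ne_top hf a ?_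
  rw [h]
  exact ENNReal.mul_top ((mem_support_iff _ _).1 ha)

theorem expect_bind_of_nonneg {q : PMF α} {k : α → PMF β} {f : β → ℝ}
    (hf : (q.bind k).HasExpect f) (h0 : ∀ b, 0 ≤ f b) :
    q.HasExpect (fun a => (k a).expect f) ∧
      (q.bind k).expect f = q.expect fun a => (k a).expect f := by
  have key : (q.mean fun a => ENNReal.ofReal ((k a).expect f)) =
      (q.bind k).mean fun b => ENNReal.ofReal (f b) := by
    rw [mean_bind]
    refine mean_congr fun a ha => ?_
    have := hasExpect_of_mem_support_bind hf ha
    rw [hasExpect_iff] at this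
    simp only [abs_of_nonneg (h0 _)] at this
    rw [expect_of_nonneg _ h0, ENNReal.ofReal_toReal this]
  have hn : ∀ a, 0 ≤ (k a).expect f := fun a => expect_nonneg fun b _ => h0 b
  constructor
  · rw [hasExpect_iff] at *
    simp only [abs_of_nonneg (h0 _), abs_of_nonneg (hn _)] at *
    rwa [key]
  · rw [expect_of_nonneg _ h0, expect_of_nonneg _ hn, key]

/-- Fubini, obtained from the nonnegative case by splitting `f` into its positive and negative
parts. -/
theorem hasExpect_and_expect_bind {q : PMF α} {k : α → PMF β} {f : β → ℝ} (hf : (q.bind k).HasExpect f) :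
    q.HasExpect (fun a => (k a).expect f) ∧
      (q.bind k).expect f = q.expect fun a => (k a).expect f := by
  have e : f = fun b => max (f b) 0 - max (- f b) 0 := by
    funext b
    rcases le_total (f b) 0 with h | h
    · rw [max_eq_right h, max_eq_left (by linarith)]; ring
    · rw [max_eq_left h, max_eq_right (by linarith)]; ring
  have h1 : (q.bind k).HasExpect fun b => max (f b) 0 := hf.abs.mono fun b _ => by
    rw [abs_of_nonneg (le_max_right _ _)]
    exact max_le (le_abs_self _) (abs_nonneg _)
  have h2 : (q.bind k).HasExpect fun b => max (- f b) 0 := hf.abs.mono fun b _ => by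
    rw [abs_of_nonneg (le_max_right _ _)]
    exact max_le (neg_le_abs _) (abs_nonneg _)
  obtain ⟨a1, b1⟩ := expect_bind_of_nonneg h1 fun b => le_max_right _ _
  obtain ⟨a2, b2⟩ := expect_bind_of_nonneg h2 fun b => le_max_right _ _
  have e' : ∀ a ∈ q.support, (k a).expect (fun b => max (f b) 0) -
      (k a).expect (fun b => max (- f b) 0) = (k a).expect f := fun a ha => by
    rw [← expect_sub (hasExpect_of_mem_support_bind h1 ha) (hasExpect_of_mem_support_bind h2 ha), ← e]
  constructor
  · exact (a1.sub a2).congr e'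
  · rw [← expect_congr e', expect_sub a1 a2, ← b1, ← b2, ← expect_sub h1 h2, ← e]

theorem HasExpect.of_bind {q : PMF α} {k : α → PMF β} {f : β → ℝ}
    (hf : (q.bind k).HasExpect f) : q.HasExpect fun a => (k a).expect f :=
  (hasExpect_and_expect_bind hf).1

theorem expect_bind {q : PMF α} {k : α → PMF β} {f : β → ℝ} (hf : (q.bind k).HasExpect f) :
    (q.bind k).expect f = q.expect fun a => (k a).expect f :=
  (hasExpect_and_expect_bind hf).2

theorem hasExpect_map {q : PMF α} {g : α → β} {f : β → ℝ} :
    (q.map g).HasExpect f ↔ q.HasExpect fun a => f (g a) := by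
  rw [hasExpect_iff, hasExpect_iff, mean_map]

theorem expect_pure (a : α) (f : α → ℝ) : (PMF.pure a).expect f = f a := by
  classical
  rw [expect, tsum_eq_single a]
  · simp
  · intro b hb
    simp [pure_apply, hb]

theorem expect_map {q : PMF α} {g : α → β} {f : β → ℝ} (hf : q.HasExpect fun a => f (g a)) :
    (q.map g).expect f = q.expect fun a => f (g a) := by
  rw [map, expect_bind]
  · simp only [Function.comp_apply, expect_pure]
  · exact hasExpect_map.mpr hf

theorem hasExpect_fintype [Finite α] (q : PMF α) (f : α → ℝ) : q.HasExpect f :=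
  Summable.of_finite

theorem expect_fintype [Fintype α] (q : PMF α) (f : α → ℝ) :
    q.expect f = ∑ a, (q a).toReal * f a := by
  rw [expect, tsum_fintype]

theorem expect_uniformOfFintype [Fintype α] [Nonempty α] (f : α → ℝ) :
    (uniformOfFintype α).expect f = (∑ a, f a) / Fintype.card α := by
  rw [expect_fintype, Finset.sum_div]
  refine Finset.sum_congr rfl fun a _ => ?_
  rw [uniformOfFintype_apply, ENNReal.toReal_inv, ENNReal.toReal_natCast]
  ring

set_option linter.deprecated false in
theorem expect_bernoulli {p : ℝ≥0} (h : p ≤ 1) (f : Bool → ℝ) :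
    (bernoulli p h).expect f = p * f true + (1 - p) * f false := by
  rw [expect_fintype, Fintype.sum_bool]
  simp only [bernoulli_apply, cond_true, cond_false, ENNReal.coe_toReal]
  rw [NNReal.coe_sub h, NNReal.coe_one]

set_option linter.deprecated false in
theorem mean_bernoulli {p : ℝ≥0} (h : p ≤ 1) (f : Bool → ℝ≥0∞) :
    (bernoulli p h).mean f = p * f true + (1 - p) * f false := by
  rw [mean_fintype, Fintype.sum_bool]
  simp only [bernoulli_apply, cond_true, cond_false, ENNReal.coe_sub, ENNReal.coe_one]

theorem mean_uniformOfFintype [Fintype α] [Nonempty α] (f : α → ℝ≥0∞) :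
    (uniformOfFintype α).mean f = (∑ a, f a) / Fintype.card α := by
  rw [mean_fintype, ENNReal.div_eq_inv_mul, Finset.mul_sum]
  simp only [uniformOfFintype_apply]

theorem map_const_eq_pure (q : PMF α) (c : β) : (q.map fun _ => c) = PMF.pure c := by
  rw [map]
  exact bind_const q _

theorem map_congr {q : PMF α} {f g : α → β} (h : ∀ a ∈ q.support, f a = g a) :
    q.map f = q.map g := by
  ext b
  rw [map_apply, map_apply]
  refine tsum_congr fun a => ?_
  by_cases ha : q a = 0
  · simp [ha]
  · rw [h a ((mem_support_iff _ _).2 ha)]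

end PMF

/-! ### Degree statistics of a community and their change under the two operations -/

namespace CommunityHypergraph

variable {r : ℕ} {M : Type} [AddCommMonoid M]

/-- The sum of `f (deg v)` over the vertices `v` of community `j`. -/
def commSum (G : CommunityHypergraph r) (j : Fin r) (f : ℕ → M) : M :=
  ∑ v ∈ Finset.univ.filter (fun v => G.comm v = j), f (G.degree v)

theorem commSize_eq_commSum (G : CommunityHypergraph r) (j : Fin r) :
    G.commSize j = G.commSum j fun _ => 1 := by
  rw [commSize, commSum, Finset.card_eq_sum_ones]

theorem commVolume_eq_commSum (G : CommunityHypergraph r) (j : Fin r) :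
    G.commVolume j = G.commSum j id := rfl

theorem degree_addEdge (G : CommunityHypergraph r) (e : Multiset (Fin G.size)) (v : Fin G.size) :
    (G.addEdge e).degree v = G.degree v + e.count v := by
  change ((e ::ₘ G.edges).map (Multiset.count v)).sum = _
  rw [Multiset.map_cons, Multiset.sum_cons, add_comm]
  rfl

theorem degree_addVertex_castSucc (G : CommunityHypergraph r) (i : Fin r) (v : Fin G.size) :
    (G.addVertex i).degree v.castSucc = G.degree v := by
  change ((G.edges.map (Multiset.map Fin.castSucc)).map
    (Multiset.count (Fin.castSucc v))).sum = _
  have h : (Multiset.count v.castSucc ∘ Multiset.map Fin.castSucc) =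
      Multiset.count (α := Fin G.size) v := by
    funext e
    exact Multiset.count_map_eq_count' _ _ (Fin.castSucc_injective _) _
  rw [Multiset.map_map, h]
  rfl

theorem degree_addVertex_last (G : CommunityHypergraph r) (i : Fin r) :
    (G.addVertex i).degree (Fin.last G.size) = 0 := by
  change ((G.edges.map (Multiset.map Fin.castSucc)).map
    (Multiset.count (Fin.last G.size))).sum = 0
  have h : (Multiset.count (Fin.last G.size) ∘ Multiset.map Fin.castSucc) = fun _ => 0 := by
    funext e
    simp [Fin.castSucc_ne_last]
  rw [Multiset.map_map, h]
  simp

theorem commSum_addEdge (G : CommunityHypergraph r) (e : Multiset (Fin G.size)) (j : Fin r)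
    (f : ℕ → M) : (G.addEdge e).commSum j f =
      ∑ v ∈ Finset.univ.filter (fun v => G.comm v = j), f (G.degree v + e.count v) := by
  exact Finset.sum_congr rfl fun v _ => congrArg f (G.degree_addEdge e v)

theorem commSum_addVertex (G : CommunityHypergraph r) (i j : Fin r) (f : ℕ → M) :
    (G.addVertex i).commSum j f = G.commSum j f + if i = j then f 0 else 0 := by
  simp only [commSum, Finset.sum_filter]
  have := Fin.sum_univ_castSucc (n := G.size)
    (fun v => if (G.addVertex i).comm v = j then f ((G.addVertex i).degree v) else 0)
  refine this.trans ?_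
  simp only [degree_addVertex_castSucc, degree_addVertex_last]
  simp [addVertex]

theorem commSize_addEdge (G : CommunityHypergraph r) (e : Multiset (Fin G.size)) (j : Fin r) :
    (G.addEdge e).commSize j = G.commSize j := rfl

theorem commSize_addVertex (G : CommunityHypergraph r) (i j : Fin r) :
    (G.addVertex i).commSize j = G.commSize j + if i = j then 1 else 0 := by
  simp only [commSize_eq_commSum, commSum_addVertex]

theorem commVolume_addVertex (G : CommunityHypergraph r) (i j : Fin r) :
    (G.addVertex i).commVolume j = G.commVolume j := by
  simp [commVolume_eq_commSum, commSum_addVertex]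

/-- The number of elements of `e`, with multiplicity, in community `j`. -/
def commCount (G : CommunityHypergraph r) (j : Fin r) : Multiset (Fin G.size) →+ ℕ :=
  Multiset.countPAddMonoidHom fun v => G.comm v = j

theorem commCount_singleton (G : CommunityHypergraph r) (j : Fin r) (v : Fin G.size) :
    G.commCount j {v} = if G.comm v = j then 1 else 0 := by
  rw [commCount, Multiset.coe_countPAddMonoidHom, ← Multiset.cons_zero, Multiset.countP_cons,
    Multiset.countP_zero, zero_add]

theorem commVolume_addEdge (G : CommunityHypergraph r) (e : Multiset (Fin G.size)) (j : Fin r) :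
    (G.addEdge e).commVolume j = G.commVolume j + G.commCount j e := by
  rw [commVolume_eq_commSum, commSum_addEdge]
  simp only [id, Finset.sum_add_distrib]
  congr 1
  simp only [commCount, Multiset.coe_countPAddMonoidHom]
  induction e using Multiset.induction with
  | empty => simp
  | cons a e ih =>
    simp only [Multiset.count_cons, Finset.sum_add_distrib, ih, Multiset.countP_cons,
      Finset.sum_ite_eq', Finset.mem_filter, Finset.mem_univ, true_and]

theorem size_eq_sum (G : CommunityHypergraph r) : G.size = ∑ j, G.commSize j := by
  have := Finset.card_eq_sum_card_fiberwise (s := Finset.univ) (t := Finset.univ) (f := G.comm)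
    (fun v _ => Finset.mem_univ _)
  simpa [commSize] using this

theorem numDegree_eq_sum (G : CommunityHypergraph r) (k : ℕ) :
    G.numDegree k = ∑ j, G.commSum j fun n => if n = k then 1 else 0 := by
  have := Finset.card_eq_sum_card_fiberwise (s := Finset.univ.filter fun v => G.degree v = k)
    (t := Finset.univ) (f := G.comm) (fun v _ => Finset.mem_univ _)
  rw [numDegree, this]
  refine Finset.sum_congr rfl fun j _ => ?_
  rw [commSum, ← Finset.card_filter, Finset.filter_filter, Finset.filter_filter]
  congr 1
  ext v
  simp [and_comm]

/-- The total weight of community `j`. -/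
def commWeight (G : CommunityHypergraph r) (γ : ℝ) (j : Fin r) : ℝ :=
  G.commVolume j + γ * G.commSize j

theorem commWeight_eq_sum (G : CommunityHypergraph r) (γ : ℝ) (j : Fin r) :
    G.commWeight γ j = G.commSum j fun n => (n : ℝ) + γ := by
  simp only [commWeight, commSum, commVolume, commSize, Finset.sum_add_distrib,
    Finset.sum_const, nsmul_eq_mul]
  push_cast
  ring

theorem commVolume_pos (G : CommunityHypergraph r) (j : Fin r) : 0 < G.commVolume j := by
  obtain ⟨v, hv, hd⟩ := G.covered j
  exact Finset.sum_pos' (fun _ _ => Nat.zero_le _) ⟨v, by simpa using hv, hd⟩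

theorem commWeight_pos (G : CommunityHypergraph r) {γ : ℝ} (hγ : 0 ≤ γ) (j : Fin r) :
    0 < G.commWeight γ j := by
  have : (0 : ℝ) < G.commVolume j := by exact_mod_cast G.commVolume_pos j
  unfold commWeight
  positivity

theorem comm_of_mem_support_choose (G : CommunityHypergraph r) (γ : ℝ≥0) (i : Fin r)
    {v : Fin G.size} (hv : v ∈ (G.choose γ i).support) : G.comm v = i := by
  rw [choose, PMF.mem_support_normalize_iff, weight] at hv
  by_contra h
  exact hv (if_neg h)

theorem choose_toReal (G : CommunityHypergraph r) (γ : ℝ≥0) (v : Fin G.size) :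
    (G.choose γ (G.comm v) v).toReal = (G.degree v + γ) / G.commWeight γ (G.comm v) := by
  rw [choose, PMF.normalize_apply, ENNReal.toReal_mul, ENNReal.toReal_inv, div_eq_mul_inv,
    tsum_fintype, ENNReal.toReal_sum, commWeight_eq_sum, commSum, Finset.sum_filter]
  · congr 2
    · simp [weight, ENNReal.toReal_add]
    · refine Finset.sum_congr rfl fun u _ => ?_
      unfold weight
      split_ifs
      · simp [ENNReal.toReal_add]
      · simp
  · intro u _
    unfold weight
    split_ifs
    · exact ENNReal.add_ne_top.2 ⟨ENNReal.natCast_ne_top _, ENNReal.coe_ne_top⟩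
    · exact ENNReal.zero_ne_top

end CommunityHypergraph

/-! ### Additive statistics of random multisets -/

namespace PMF

variable {α ι : Type}

theorem map_iidMultiset_succ (q : PMF α) (n : ℕ) (φ : Multiset α →+ ℕ) :
    (q.iidMultiset (n + 1)).map φ =
      q.bind fun a => ((q.iidMultiset n).map φ).map fun m => φ {a} + m := by
  rw [iidMultiset, map_bind]
  congr 1
  funext a
  rw [map_comp, map_comp]
  congr 1
  funext e
  simp only [Function.comp_apply, ← Multiset.singleton_add, map_add]

theorem map_iidMultiset_eq_zero (q : PMF α) (φ : Multiset α →+ ℕ)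
    (h : ∀ a ∈ q.support, φ {a} = 0) (n : ℕ) : (q.iidMultiset n).map φ = PMF.pure 0 := by
  induction n with
  | zero => rw [iidMultiset, pure_map, map_zero]
  | succ n ih =>
    rw [map_iidMultiset_succ, ih]
    simp only [pure_map, add_zero]
    rw [show (q.bind fun a => PMF.pure (φ {a})) = q.map fun a => φ {a} from rfl,
      map_congr (g := fun _ => 0) h, map_const_eq_pure]

theorem map_iidMultiset_eq_length (q : PMF α) (φ : Multiset α →+ ℕ)
    (h : ∀ a ∈ q.support, φ {a} = 1) (n : ℕ) : (q.iidMultiset n).map φ = PMF.pure n := by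
  induction n with
  | zero => rw [iidMultiset, pure_map, map_zero]
  | succ n ih =>
    rw [map_iidMultiset_succ, ih]
    simp only [pure_map]
    rw [show (q.bind fun a => PMF.pure (φ {a} + n)) = q.map fun a => φ {a} + n from rfl,
      map_congr (g := fun _ => n + 1) fun a ha => by rw [h a ha, add_comm], map_const_eq_pure]

/-- An additive statistic that sees only community `j` ignores all other parts of the union; as the
list has no repetition, part `j` is sampled at most once. -/
theorem map_indepUnion [DecidableEq ι] (f : ι → PMF (Multiset α)) (φ : Multiset α →+ ℕ) (j : ι)
    (h : ∀ i ≠ j, (f i).map φ = PMF.pure 0) {l : List ι} (hl : l.Nodup) :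
    (indepUnion f l).map φ = if j ∈ l then (f j).map φ else PMF.pure 0 := by
  induction l with
  | nil => rw [indepUnion, pure_map, map_zero, if_neg List.not_mem_nil]
  | cons i l ih =>
    rw [List.nodup_cons] at hl
    have e : (indepUnion f (i :: l)).map φ =
        ((f i).map φ).bind fun n => ((indepUnion f l).map φ).map fun m => n + m := by
      rw [indepUnion, map_bind, bind_map]
      congr 1
      funext a
      rw [map_comp, Function.comp_apply, map_comp]
      congr 1
      funext b
      simp only [Function.comp_apply, map_add]
    rw [e, ih hl.2]
    by_cases hij : i = j
    · subst hij
      rw [if_neg hl.1, if_pos List.mem_cons_self]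
      simp only [pure_map, add_zero, bind_pure]
    · rw [h i hij, pure_bind]
      simp only [zero_add, List.mem_cons, Ne.symm hij, false_or]
      exact map_id _

end PMF

/-! ### Increments of the size and the volume of a community -/

namespace CommunityModel

variable {r d : ℕ} [NeZero r]

/-- Applied twice: to the number of sampled vertices in a community, which gives the volume, and to
the multiplicity of one vertex, which gives the degrees. -/
theorem map_newEdge (A : CommunityModel r d) (G : CommunityHypergraph r) (S : Finset (Fin r))
    (x : Fin r → ℕ) (j : Fin r) (φ : Multiset (Fin G.size) →+ ℕ)
    (hφ : ∀ v, G.comm v ≠ j → φ {v} = 0) :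
    (A.newEdge G S x).map φ = if j ∈ S then (PMF.uniformOfFintype (Fin r)).bind fun i =>
      ((G.choose A.γ j).iidMultiset (x i)).map φ else PMF.pure 0 := by
  rw [newEdge, PMF.map_indepUnion _ φ j]
  · simp only [List.mem_filter, List.mem_finRange, true_and, decide_eq_true_eq, PMF.map_bind]
  · intro i hi
    rw [PMF.map_bind]
    rw [show (fun a => ((G.choose A.γ i).iidMultiset (x a)).map φ) =
      fun _ : Fin r => PMF.pure 0 from funext fun a => PMF.map_iidMultiset_eq_zero _ _
        (fun v hv => hφ v (by rw [G.comm_of_mem_support_choose _ _ hv]; exact hi)) _]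
    exact PMF.bind_const _ _
  · exact (List.nodup_finRange r).filter _

theorem map_newEdge_commCount (A : CommunityModel r d) (G : CommunityHypergraph r)
    (S : Finset (Fin r)) (x : Fin r → ℕ) (j : Fin r) :
    (A.newEdge G S x).map (G.commCount j) =
      if j ∈ S then (PMF.uniformOfFintype (Fin r)).map x else PMF.pure 0 := by
  rw [A.map_newEdge G S x j]
  · congr 1
    rw [show (fun i => ((G.choose A.γ j).iidMultiset (x i)).map (G.commCount j)) =
      fun i => PMF.pure (x i) from funext fun i => PMF.map_iidMultiset_eq_length _ _
        (fun v hv => by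
          rw [G.commCount_singleton, if_pos (G.comm_of_mem_support_choose _ _ hv)]) _]
    rfl
  · intro v hv
    rw [G.commCount_singleton, if_neg hv]

set_option linter.deprecated false in
/-- The joint law of the number of vertices added to community `j` and of the increase of the
sum of the degrees in community `j` in the step from `t` to `t + 1`. -/
def increment (A : CommunityModel r d) (t : ℕ) (j : Fin r) : PMF (ℕ × ℕ) :=
  (PMF.bernoulli A.p A.p_lt_one.le).bind fun isVertexStep =>
    if isVertexStep then A.M.map fun i => (if i = j then 1 else 0, 0)
    else A.P.toPMF.bind fun S => (A.X t).bind fun x =>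
      if j ∈ S then (PMF.uniformOfFintype (Fin r)).map fun i => (0, x i) else PMF.pure (0, 0)

/-- The number of vertices drawn from a community is settled before the vertices themselves, so the
increment does not feel the degrees. This makes size and volume accessible without any knowledge of
`G`. -/
theorem map_step (A : CommunityModel r d) (t : ℕ) (G : CommunityHypergraph r) (j : Fin r) :
    (A.step t G).map (fun G' => (G'.commSize j, G'.commVolume j)) =
      (A.increment t j).map fun n => (G.commSize j + n.1, G.commVolume j + n.2) := by
  rw [step, increment, PMF.map_bind, PMF.map_bind]
  congr 1
  funext b
  cases b
  · simp only [Bool.false_eq_true, if_false, PMF.map_bind]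
    congr 1
    funext S
    congr 1
    funext x
    rw [PMF.map_comp]
    have e : (fun G' : CommunityHypergraph r => (G'.commSize j, G'.commVolume j)) ∘ G.addEdge =
        (fun n => (G.commSize j, G.commVolume j + n)) ∘ G.commCount j := by
      funext e
      simp only [Function.comp_apply, G.commVolume_addEdge, G.commSize_addEdge]
    rw [e, ← PMF.map_comp, A.map_newEdge_commCount]
    split_ifs
    · rw [PMF.map_comp, PMF.map_comp]
      rfl
    · rw [PMF.pure_map, PMF.pure_map]
      rfl
  · simp only [if_true, PMF.map_comp]
    congr 1
    funext i
    simp only [Function.comp_apply, G.commVolume_addVertex, G.commSize_addVertex, add_zero]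

theorem mean_step (A : CommunityModel r d) (t : ℕ) (G : CommunityHypergraph r) (j : Fin r)
    (f : ℕ → ℕ → ℝ≥0∞) :
    ((A.step t G).mean fun G' => f (G'.commSize j) (G'.commVolume j)) =
      (A.increment t j).mean fun n => f (G.commSize j + n.1) (G.commVolume j + n.2) := by
  have := congrArg (fun q => q.mean fun n => f n.1 n.2) (A.map_step t G j)
  simpa only [PMF.mean_map] using this

theorem meanNewVertices_eq_increment (A : CommunityModel r d) (t : ℕ) (j : Fin r) :
    A.meanNewVertices t j = (A.increment t j).mean fun n => (n.1 : ℝ≥0∞) := by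
  rw [meanNewVertices]
  rw [PMF.mean_congr fun G _ => A.mean_step t G j fun a _ => ((a - G.commSize j : ℕ) : ℝ≥0∞)]
  simp only [add_tsub_cancel_left, PMF.mean_const]

theorem meanDegreeIncrease_eq_increment (A : CommunityModel r d) (t : ℕ) (j : Fin r) :
    A.meanDegreeIncrease t j = (A.increment t j).mean fun n => (n.2 : ℝ≥0∞) := by
  rw [meanDegreeIncrease]
  rw [PMF.mean_congr fun G _ => A.mean_step t G j fun _ a => ((a - G.commVolume j : ℕ) : ℝ≥0∞)]
  simp only [add_tsub_cancel_left, PMF.mean_const]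

theorem increment_mean_fst (A : CommunityModel r d) (t : ℕ) (j : Fin r) :
    ((A.increment t j).mean fun n => (n.1 : ℝ≥0∞)) = A.p * A.M j := by
  rw [increment, PMF.mean_bind, PMF.mean_bernoulli]
  simp only [if_true, Bool.false_eq_true, if_false, PMF.mean_map, PMF.mean_bind]
  have h : ∀ S : Finset (Fin r), ∀ x : Fin r → ℕ, ((if j ∈ S then
      (PMF.uniformOfFintype (Fin r)).map fun i => ((0 : ℕ), x i) else PMF.pure (0, 0)).mean
        fun n => (n.1 : ℝ≥0∞)) = 0 := by
    intro S x
    split_ifs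
    · simp [PMF.mean_map, PMF.mean_const]
    · simp [PMF.mean_pure]
  simp only [h, PMF.mean_const, mul_zero, add_zero]
  rw [PMF.mean_fintype]
  simp

/-- The uniform index averages the coordinates of `X t`; by linearity only their separate means
enter, so they may be dependent. -/
theorem increment_mean_snd (A : CommunityModel r d) (μ : Fin r → ℝ≥0)
    (hmean : ∀ t i, (A.X t).mean (fun x => (x i : ℝ≥0∞)) = μ i) (t : ℕ) (j : Fin r) :
    ((A.increment t j).mean fun n => (n.2 : ℝ≥0∞)) =
      (1 - A.p) * A.P.share j * ((∑ i, (μ i : ℝ≥0∞)) / r) := by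
  rw [increment, PMF.mean_bind, PMF.mean_bernoulli]
  simp only [if_true, Bool.false_eq_true, if_false, PMF.mean_map, PMF.mean_bind, Nat.cast_zero,
    PMF.mean_const, mul_zero, zero_add]
  have h : ∀ S : Finset (Fin r), ((A.X t).mean fun x => (if j ∈ S then
      (PMF.uniformOfFintype (Fin r)).map fun i => ((0 : ℕ), x i) else PMF.pure (0, 0)).mean
        fun n => (n.2 : ℝ≥0∞)) = if j ∈ S then (∑ i, (μ i : ℝ≥0∞)) / r else 0 := by
    intro S
    split_ifs with hS
    · simp only [PMF.mean_map, PMF.mean_uniformOfFintype, Fintype.card_fin, div_eq_mul_inv]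
      simp only [mul_comm _ ((r : ℝ≥0∞)⁻¹), PMF.mean_const_mul]
      congr 1
      simp only [← hmean t, PMF.mean, Finset.mul_sum]
      exact Summable.tsum_finsetSum fun i _ => ENNReal.summable
    · simp [PMF.mean_pure, PMF.mean_const]
  simp only [h]
  rw [PMF.mean_fintype, HyperedgeMatrix.share, Finset.sum_filter, mul_assoc, Finset.sum_mul]
  congr 1
  refine Finset.sum_congr rfl fun S _ => ?_
  split_ifs <;> simp

end CommunityModel

/-- Carries integrability and expectation across an equality of image laws such as `map_step`. -/
theorem PMF.expect_eq_of_map_eq {α β δ : Type} {q : PMF α} {q' : PMF β} {g : α → δ} {g' : β → δ}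
    (e : q.map g = q'.map g') (f : δ → ℝ) (hf : q'.HasExpect fun b => f (g' b)) :
    (q.HasExpect fun a => f (g a)) ∧
      (q.expect fun a => f (g a)) = q'.expect fun b => f (g' b) := by
  have h : q.HasExpect fun a => f (g a) := by
    rw [← PMF.hasExpect_map, e, PMF.hasExpect_map]
    exact hf
  exact ⟨h, by rw [← PMF.expect_map h, e, PMF.expect_map hf]⟩

/-! ### Real-valued rates and integrability at every time -/

namespace CommunityModel

variable {r d : ℕ}

/-- The expected number of vertices added to community `j` in a step, as a real number. -/
def vertexRate (A : CommunityModel r d) (j : Fin r) : ℝ := A.p * (A.M j).toReal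

/-- The expected increase of the volume of community `j` in a step, as a real number. -/
def degreeRate (A : CommunityModel r d) (μ : Fin r → ℝ≥0) (j : Fin r) : ℝ :=
  (1 - A.p) * (A.P.share j).toReal * ((∑ i, (μ i : ℝ)) / r)

/-- All the sizes that `X t` can take are smaller than `t ^ (1 / 4)`. -/
def SmallSizes (A : CommunityModel r d) (t : ℕ) : Prop :=
  ∀ x ∈ (A.X t).support, ∀ i, (x i : ℝ) < (t : ℝ) ^ (1 / 4 : ℝ)

theorem share_ne_top (A : CommunityModel r d) (j : Fin r) : A.P.share j ≠ ∞ :=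
  (ENNReal.sum_lt_top.mpr fun S _ => (A.P.toPMF.apply_lt_top S)).ne

theorem vertexRate_pos (A : CommunityModel r d) (j : Fin r) : 0 < A.vertexRate j :=
  mul_pos (by exact_mod_cast A.p_pos) (ENNReal.toReal_pos (A.M_pos j).ne' (A.M.apply_ne_top j))

theorem p_real_lt_one (A : CommunityModel r d) : (A.p : ℝ) < 1 := by exact_mod_cast A.p_lt_one

theorem degreeRate_nonneg (A : CommunityModel r d) (μ : Fin r → ℝ≥0) (j : Fin r) :
    0 ≤ A.degreeRate μ j := by
  have := A.p_real_lt_one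
  have h : (0 : ℝ) ≤ 1 - A.p := by linarith
  have h' : 0 ≤ ∑ i, (μ i : ℝ) := Finset.sum_nonneg fun i _ => (μ i).coe_nonneg
  unfold degreeRate
  positivity

theorem toReal_degreeRate (A : CommunityModel r d) (μ : Fin r → ℝ≥0) (j : Fin r) :
    ((1 - A.p) * A.P.share j * ((∑ i, (μ i : ℝ≥0∞)) / r)).toReal = A.degreeRate μ j := by
  rw [ENNReal.toReal_mul, ENNReal.toReal_mul, ENNReal.toReal_div, ENNReal.toReal_sum,
    ENNReal.toReal_sub_of_le]
  · rfl
  · exact_mod_cast A.p_lt_one.le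
  · exact ENNReal.one_ne_top
  · exact fun i _ => ENNReal.coe_ne_top

theorem degreeRate_ne_top [NeZero r] (A : CommunityModel r d) (μ : Fin r → ℝ≥0) (j : Fin r) :
    (1 - A.p) * A.P.share j * ((∑ i, (μ i : ℝ≥0∞)) / r) ≠ ∞ := by
  refine ENNReal.mul_ne_top (ENNReal.mul_ne_top ?_ (A.share_ne_top j)) (ENNReal.div_ne_top ?_ ?_)
  · exact ne_top_of_le_ne_top ENNReal.one_ne_top tsub_le_self
  · exact (ENNReal.sum_lt_top.mpr fun i _ => ENNReal.coe_lt_top).ne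
  · exact_mod_cast NeZero.ne r

variable [NeZero r] (A : CommunityModel r d) (μ : Fin r → ℝ≥0)

theorem increment_support {t : ℕ} (ht : 1 ≤ t) (h : A.SmallSizes t) (j : Fin r) {n : ℕ × ℕ}
    (hn : n ∈ (A.increment t j).support) :
    (n.1 : ℝ) ≤ 1 ∧ (n.2 : ℝ) ≤ (t : ℝ) ^ (1 / 4 : ℝ) := by
  have h0 : (0 : ℝ) ≤ (t : ℝ) ^ (1 / 4 : ℝ) := by positivity
  rw [increment, PMF.mem_support_bind_iff] at hn
  obtain ⟨b, -, hb⟩ := hn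
  cases b
  · simp only [Bool.false_eq_true, if_false, PMF.mem_support_bind_iff] at hb
    obtain ⟨S, -, x, hx, hb⟩ := hb
    split_ifs at hb
    · rw [PMF.mem_support_map_iff] at hb
      obtain ⟨i, -, rfl⟩ := hb
      exact ⟨by simp, (h x hx i).le⟩
    · rw [PMF.mem_support_pure_iff] at hb
      subst hb
      simpa using h0
  · simp only [if_true, PMF.mem_support_map_iff] at hb
    obtain ⟨i, -, rfl⟩ := hb
    refine ⟨?_, by simpa using h0⟩
    dsimp only
    split_ifs <;> simp

section Means

variable (hmean : ∀ t i, (A.X t).mean (fun x => (x i : ℝ≥0∞)) = μ i)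

theorem hasExpect_increment_fst (t : ℕ) (j : Fin r) :
    (A.increment t j).HasExpect fun n => (n.1 : ℝ) := by
  rw [PMF.hasExpect_iff]
  simp only [Nat.abs_cast, ENNReal.ofReal_natCast]
  rw [A.increment_mean_fst]
  exact ENNReal.mul_ne_top ENNReal.coe_ne_top (A.M.apply_ne_top j)

theorem expect_increment_fst (t : ℕ) (j : Fin r) :
    ((A.increment t j).expect fun n => (n.1 : ℝ)) = A.vertexRate j := by
  rw [PMF.expect_of_nonneg _ fun n => Nat.cast_nonneg _]
  simp only [ENNReal.ofReal_natCast]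
  rw [A.increment_mean_fst, ENNReal.toReal_mul]
  rfl

include hmean

theorem hasExpect_increment_snd (t : ℕ) (j : Fin r) :
    (A.increment t j).HasExpect fun n => (n.2 : ℝ) := by
  rw [PMF.hasExpect_iff]
  simp only [Nat.abs_cast, ENNReal.ofReal_natCast]
  rw [A.increment_mean_snd μ hmean]
  exact A.degreeRate_ne_top μ j

theorem expect_increment_snd (t : ℕ) (j : Fin r) :
    ((A.increment t j).expect fun n => (n.2 : ℝ)) = A.degreeRate μ j := by
  rw [PMF.expect_of_nonneg _ fun n => Nat.cast_nonneg _]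
  simp only [ENNReal.ofReal_natCast]
  rw [A.increment_mean_snd μ hmean, A.toReal_degreeRate]

theorem mean_law_ne_top (t : ℕ) (j : Fin r) :
    ((A.law t).mean fun G => (G.commSize j : ℝ≥0∞) + G.commVolume j) ≠ ∞ := by
  induction t with
  | zero =>
    rw [law, PMF.mean_pure]
    exact ENNReal.add_ne_top.2 ⟨ENNReal.natCast_ne_top _, ENNReal.natCast_ne_top _⟩
  | succ t ih =>
    rw [law, PMF.mean_bind]
    rw [PMF.mean_congr fun G _ => A.mean_step t G j fun a b => (a : ℝ≥0∞) + b]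
    have e : ∀ G : CommunityHypergraph r, ((A.increment t j).mean fun n =>
        ((G.commSize j + n.1 : ℕ) : ℝ≥0∞) + (G.commVolume j + n.2 : ℕ)) =
        (G.commSize j : ℝ≥0∞) + G.commVolume j + (A.p * A.M j +
          (1 - A.p) * A.P.share j * ((∑ i, (μ i : ℝ≥0∞)) / r)) := by
      intro G
      rw [← A.increment_mean_fst t j, ← A.increment_mean_snd μ hmean t j, ← PMF.mean_add]
      conv_rhs => rw [← PMF.mean_const (A.increment t j) (G.commSize j + G.commVolume j : ℝ≥0∞)]
      rw [← PMF.mean_add]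
      congr 1
      funext n
      push_cast
      ring
    simp only [e, PMF.mean_add, PMF.mean_const] at ih ⊢
    refine ENNReal.add_ne_top.2 ⟨ih, ENNReal.add_ne_top.2 ⟨?_, A.degreeRate_ne_top μ j⟩⟩
    exact ENNReal.mul_ne_top ENNReal.coe_ne_top (A.M.apply_ne_top j)

theorem hasExpect_law (t : ℕ) (j : Fin r) :
    (A.law t).HasExpect fun G => (G.commSize j : ℝ) + G.commVolume j := by
  rw [PMF.hasExpect_iff]
  convert A.mean_law_ne_top μ hmean t j using 3 with G
  rw [abs_of_nonneg (by positivity), ENNReal.ofReal_add (by positivity) (by positivity),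
    ENNReal.ofReal_natCast, ENNReal.ofReal_natCast]

end Means

/-! ### Law of large numbers for size, volume and weight -/

/-- A nonnegative combination of the volume and of the size of community `j`. -/
def functional (c₁ c₂ : ℝ) (j : Fin r) (G : CommunityHypergraph r) : ℝ :=
  c₁ * G.commVolume j + c₂ * G.commSize j

theorem expect_step_of_increment (t : ℕ) (G : CommunityHypergraph r) (j : Fin r)
    (f : ℕ → ℕ → ℝ)
    (hf : (A.increment t j).HasExpect fun n => f (G.commSize j + n.1) (G.commVolume j + n.2)) :
    ((A.step t G).HasExpect fun G' => f (G'.commSize j) (G'.commVolume j)) ∧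
    ((A.step t G).expect fun G' => f (G'.commSize j) (G'.commVolume j)) =
      (A.increment t j).expect fun n => f (G.commSize j + n.1) (G.commVolume j + n.2) :=
  PMF.expect_eq_of_map_eq (A.map_step t G j) (fun n => f n.1 n.2) hf

/-- Concavity of the square root gives `√(S² + w) ≤ S + w / (2 S)` with `w = 2 y z + z²`; then `S ≥
M` is used in the quadratic term only, so that the linear term can still average to zero. -/
theorem sqrt_sq_add_le {M : ℝ} (hM : 0 < M) (y z : ℝ) :
    √(M ^ 2 + (y + z) ^ 2) ≤ √(M ^ 2 + y ^ 2) + (y / √(M ^ 2 + y ^ 2)) * z + z ^ 2 / (2 * M) := by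
  set S := √(M ^ 2 + y ^ 2) with hS
  have hSM : M ≤ S := Real.le_sqrt_of_sq_le (by nlinarith [sq_nonneg y])
  have hS0 : 0 < S := hM.trans_le hSM
  have hSS : S ^ 2 = M ^ 2 + y ^ 2 := Real.sq_sqrt (by positivity)
  have h1 : z ^ 2 / (2 * S) ≤ z ^ 2 / (2 * M) :=
    div_le_div_of_nonneg_left (sq_nonneg z) (by positivity) (by linarith)
  refine le_trans ?_ (add_le_add_right h1 _)
  have h2 : S + y / S * z + z ^ 2 / (2 * S) = S + (2 * y * z + z ^ 2) / (2 * S) := by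
    field_simp
    ring
  have h3 : |y| ≤ S := Real.abs_le_sqrt (by nlinarith [sq_nonneg M])
  have h4 : 0 ≤ S + (2 * y * z + z ^ 2) / (2 * S) := by
    rw [show S + (2 * y * z + z ^ 2) / (2 * S) = (2 * S ^ 2 + 2 * y * z + z ^ 2) / (2 * S) by
      field_simp
      ring]
    apply div_nonneg _ (by positivity)
    nlinarith [sq_nonneg (y + z), sq_nonneg M, sq_nonneg y]
  rw [h2]
  refine Real.sqrt_le_iff.mpr ⟨h4, ?_⟩
  have h5 : (S + (2 * y * z + z ^ 2) / (2 * S)) ^ 2 =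
      S ^ 2 + (2 * y * z + z ^ 2) + ((2 * y * z + z ^ 2) / (2 * S)) ^ 2 := by
    field_simp
    ring
  rw [h5, hSS]
  nlinarith [sq_nonneg ((2 * y * z + z ^ 2) / (2 * S))]

theorem sqrt_sq_add_le_add_abs {M : ℝ} (hM : 0 ≤ M) (y : ℝ) : √(M ^ 2 + y ^ 2) ≤ M + |y| := by
  refine Real.sqrt_le_iff.mpr ⟨by positivity, ?_⟩
  nlinarith [mul_nonneg hM (abs_nonneg y), sq_abs y]

theorem abs_le_sqrt_sq_add (M y : ℝ) : |y| ≤ √(M ^ 2 + y ^ 2) :=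
  Real.abs_le_sqrt (by nlinarith [sq_nonneg M])

section Concentration

variable (hmean : ∀ t i, (A.X t).mean (fun x => (x i : ℝ≥0∞)) = μ i)
variable {c₁ c₂ : ℝ} (hc₁ : 0 ≤ c₁) (hc₂ : 0 ≤ c₂) (j : Fin r)

/-- The expected increase of `functional c₁ c₂ j` in a step. -/
def functionalRate (c₁ c₂ : ℝ) (j : Fin r) : ℝ := c₁ * A.degreeRate μ j + c₂ * A.vertexRate j

omit [NeZero r] in
include hc₁ hc₂ in
theorem functionalRate_nonneg : 0 ≤ A.functionalRate μ c₁ c₂ j :=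
  add_nonneg (mul_nonneg hc₁ (A.degreeRate_nonneg μ j)) (mul_nonneg hc₂ (A.vertexRate_pos j).le)

include hmean in
theorem hasExpect_functional_sub (t : ℕ) (κ : ℝ) :
    (A.law t).HasExpect fun G => functional c₁ c₂ j G - κ := by
  have h1 : (A.law t).HasExpect fun G => (G.commVolume j : ℝ) :=
    (A.hasExpect_law μ hmean t j).mono fun G _ => by
      rw [Nat.abs_cast]; simp
  have h2 : (A.law t).HasExpect fun G => (G.commSize j : ℝ) :=
    (A.hasExpect_law μ hmean t j).mono fun G _ => by
      rw [Nat.abs_cast]; simp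
  exact ((h1.const_mul c₁).add (h2.const_mul c₂)).sub (PMF.hasExpect_const _ κ)

include hmean hc₁ hc₂ in
-- The compensated increment has mean zero, which removes the first-order term of `sqrt_sq_add_le`.
-- It is at most a constant times `t^(1/4)`, which bounds the quadratic one.
theorem expect_step_sqrt_le {t : ℕ} (ht : 1 ≤ t) (hs : A.SmallSizes t) {M : ℝ} (hM : 0 < M)
    (G : CommunityHypergraph r) :
    ((A.step t G).expect fun G' => √(M ^ 2 + (functional c₁ c₂ j G' -
      A.functionalRate μ c₁ c₂ j * ((t + 1 : ℕ) : ℝ)) ^ 2)) ≤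
    √(M ^ 2 + (functional c₁ c₂ j G - A.functionalRate μ c₁ c₂ j * t) ^ 2) +
      (c₁ + c₂ + A.functionalRate μ c₁ c₂ j) ^ 2 * (t : ℝ) ^ (1 / 2 : ℝ) / (2 * M) := by
  set κ := A.functionalRate μ c₁ c₂ j with hκ
  set C := c₁ + c₂ + κ with hC
  set y := functional c₁ c₂ j G - κ * t with hy
  set τ := (t : ℝ) ^ (1 / 4 : ℝ) with hτ
  have hκ0 : 0 ≤ κ := A.functionalRate_nonneg μ hc₁ hc₂ j
  have hC0 : 0 ≤ C := by positivity
  have hτ1 : 1 ≤ τ := Real.one_le_rpow (by exact_mod_cast ht) (by norm_num)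
  have hττ : (t : ℝ) ^ (1 / 2 : ℝ) = τ ^ 2 := by
    rw [hτ, ← Real.rpow_natCast, ← Real.rpow_mul (by positivity)]
    norm_num
  -- The increment of the functional minus its mean.
  let z : ℕ × ℕ → ℝ := fun n => c₁ * n.2 + c₂ * n.1 - κ
  have hz : ∀ n ∈ (A.increment t j).support, |z n| ≤ C * τ := by
    intro n hn
    obtain ⟨a, b⟩ := A.increment_support ht hs j hn
    have a1 : c₂ * n.1 ≤ c₂ * τ := mul_le_mul_of_nonneg_left (a.trans hτ1) hc₂
    have b1 : c₁ * n.2 ≤ c₁ * τ := mul_le_mul_of_nonneg_left b hc₁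
    have a2 : 0 ≤ c₂ * n.1 := by positivity
    have b2 : 0 ≤ c₁ * n.2 := by positivity
    have k1 : κ ≤ κ * τ := le_mul_of_one_le_right hκ0 hτ1
    have c1 : 0 ≤ c₁ * τ := by positivity
    have c2 : 0 ≤ c₂ * τ := by positivity
    rw [abs_le]
    constructor <;> simp only [z, hC] <;> nlinarith
  have hz1 : (A.increment t j).HasExpect z :=
    (((A.hasExpect_increment_snd μ hmean t j).const_mul c₁).add
      ((A.hasExpect_increment_fst t j).const_mul c₂)).sub (PMF.hasExpect_const _ κ)
  have hz0 : (A.increment t j).expect z = 0 := by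
    have e := PMF.expect_sub (((A.hasExpect_increment_snd μ hmean t j).const_mul c₁).add
      ((A.hasExpect_increment_fst t j).const_mul c₂)) (PMF.hasExpect_const (A.increment t j) κ)
    rw [PMF.expect_add ((A.hasExpect_increment_snd μ hmean t j).const_mul c₁)
      ((A.hasExpect_increment_fst t j).const_mul c₂), PMF.expect_const_mul, PMF.expect_const_mul,
      PMF.expect_const, A.expect_increment_fst, A.expect_increment_snd μ hmean] at e
    refine e.trans ?_
    rw [hκ, functionalRate, sub_self]
  have hsq : ∀ n ∈ (A.increment t j).support, z n ^ 2 ≤ C ^ 2 * τ ^ 2 := fun n hn => by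
    rw [← mul_pow, ← sq_abs]
    exact pow_le_pow_left₀ (abs_nonneg _) (hz n hn) 2
  have hbd : (A.increment t j).HasExpect fun n => √(M ^ 2 + (y + z n) ^ 2) := by
    refine PMF.hasExpect_of_bounded (M + (|y| + C * τ)) fun n hn => ?_
    rw [abs_of_nonneg (Real.sqrt_nonneg _)]
    refine (sqrt_sq_add_le_add_abs hM.le _).trans ?_
    have := abs_add_le y (z n)
    have := hz n hn
    linarith
  obtain ⟨-, e⟩ := A.expect_step_of_increment t G j
    (fun a b => √(M ^ 2 + (c₁ * b + c₂ * a - κ * ((t + 1 : ℕ) : ℝ)) ^ 2))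
    (hbd.congr fun n _ => by
      congr 3
      simp only [z, hy, functional]
      push_cast
      ring)
  have e' : ((A.increment t j).expect fun n => √(M ^ 2 + (c₁ * ((G.commVolume j + n.2 : ℕ) : ℝ)
      + c₂ * ((G.commSize j + n.1 : ℕ) : ℝ) - κ * ((t + 1 : ℕ) : ℝ)) ^ 2)) =
      (A.increment t j).expect fun n => √(M ^ 2 + (y + z n) ^ 2) :=
    PMF.expect_congr fun n _ => by
      congr 3
      simp only [z, hy, functional]
      push_cast
      ring
  rw [hττ]
  refine (e.trans e').le.trans ?_
  have hlin := (PMF.hasExpect_const (A.increment t j) √(M ^ 2 + y ^ 2)).add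
    (hz1.const_mul (y / √(M ^ 2 + y ^ 2)))
  have hup := hlin.add (PMF.hasExpect_const (A.increment t j) (C ^ 2 * τ ^ 2 / (2 * M)))
  refine (PMF.expect_mono hbd hup fun n hn => ?_).trans ?_
  · refine (sqrt_sq_add_le hM y (z n)).trans (add_le_add_right ?_ _)
    exact div_le_div_of_nonneg_right (hsq n hn) (by positivity)
  · rw [PMF.expect_add hlin (PMF.hasExpect_const _ _), PMF.expect_add (PMF.hasExpect_const _ _)
      (hz1.const_mul _), PMF.expect_const, PMF.expect_const, PMF.expect_const_mul, hz0]
    simp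

theorem hasExpect_law_succ {t : ℕ} {f : CommunityHypergraph r → ℝ}
    (hf : (A.law (t + 1)).HasExpect f) : (A.law t).HasExpect fun G => (A.step t G).expect f :=
  PMF.HasExpect.of_bind (k := A.step t) hf

theorem expect_law_succ {t : ℕ} {f : CommunityHypergraph r → ℝ}
    (hf : (A.law (t + 1)).HasExpect f) :
    (A.law (t + 1)).expect f = (A.law t).expect fun G => (A.step t G).expect f :=
  PMF.expect_bind (k := A.step t) hf

include hmean in
theorem hasExpect_sqrt (t : ℕ) {M : ℝ} (hM : 0 < M) (κ : ℝ) :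
    (A.law t).HasExpect fun G => √(M ^ 2 + (functional c₁ c₂ j G - κ) ^ 2) :=
  ((PMF.hasExpect_const _ M).add (A.hasExpect_functional_sub μ hmean j t κ).abs).mono
    fun G _ => by
      rw [abs_of_nonneg (Real.sqrt_nonneg _)]
      exact sqrt_sq_add_le_add_abs hM.le _

include hmean hc₁ hc₂ in
-- The one-step bounds are summed from `T` on, each replaced by its value at the final time. The
-- parameter `M` stays fixed along the way, so it may later depend on that final time.
theorem expect_sqrt_le {T : ℕ} (hT : 1 ≤ T) (hs : ∀ t, T ≤ t → A.SmallSizes t) {M : ℝ}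
    (hM : 0 < M) {t : ℕ} (ht : T ≤ t) :
    ((A.law t).expect fun G => √(M ^ 2 + (functional c₁ c₂ j G -
      A.functionalRate μ c₁ c₂ j * t) ^ 2)) ≤
    ((A.law T).expect fun G => √(M ^ 2 + (functional c₁ c₂ j G -
      A.functionalRate μ c₁ c₂ j * T) ^ 2)) +
      t * ((c₁ + c₂ + A.functionalRate μ c₁ c₂ j) ^ 2 * (t : ℝ) ^ (1 / 2 : ℝ) / (2 * M)) := by
  induction t, ht using Nat.le_induction with
  | base => simp only [le_add_iff_nonneg_right]; positivity
  | succ t ht ih =>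
    have h1 := A.hasExpect_sqrt μ hmean j (c₁ := c₁) (c₂ := c₂) (t + 1) hM
      (A.functionalRate μ c₁ c₂ j * ((t + 1 : ℕ) : ℝ))
    have h2 := A.hasExpect_sqrt μ hmean j (c₁ := c₁) (c₂ := c₂) t hM
      (A.functionalRate μ c₁ c₂ j * t)
    rw [A.expect_law_succ h1]
    refine (PMF.expect_mono (A.hasExpect_law_succ h1) (h2.add (PMF.hasExpect_const _ _))
      fun G _ => A.expect_step_sqrt_le μ hmean hc₁ hc₂ j (hT.trans ht) (hs t ht) hM G).trans ?_
    rw [PMF.expect_add h2 (PMF.hasExpect_const _ _), PMF.expect_const]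
    set C2 := (c₁ + c₂ + A.functionalRate μ c₁ c₂ j) ^ 2
    have hmono : C2 * (t : ℝ) ^ (1 / 2 : ℝ) / (2 * M) ≤
        C2 * ((t + 1 : ℕ) : ℝ) ^ (1 / 2 : ℝ) / (2 * M) := by
      have : (t : ℝ) ^ (1 / 2 : ℝ) ≤ ((t + 1 : ℕ) : ℝ) ^ (1 / 2 : ℝ) :=
        Real.rpow_le_rpow (by positivity) (by push_cast; linarith) (by norm_num)
      gcongr
    have h3 := mul_le_mul_of_nonneg_left hmono (Nat.cast_nonneg (α := ℝ) t)
    have h4 : ((t + 1 : ℕ) : ℝ) * (C2 * ((t + 1 : ℕ) : ℝ) ^ (1 / 2 : ℝ) / (2 * M)) =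
        t * (C2 * ((t + 1 : ℕ) : ℝ) ^ (1 / 2 : ℝ) / (2 * M)) +
          C2 * ((t + 1 : ℕ) : ℝ) ^ (1 / 2 : ℝ) / (2 * M) := by push_cast; ring
    rw [h4]
    linarith

include hmean hc₁ hc₂ in
/-- The law of large numbers for the volume and the size of a community, in mean. -/
theorem tendsto_expect_abs_functional_sub (hs : ∀ᶠ t in atTop, A.SmallSizes t) :
    Tendsto (fun t : ℕ => ((A.law t).expect fun G =>
      |functional c₁ c₂ j G - A.functionalRate μ c₁ c₂ j * t|) / t) atTop (𝓝 0) := by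
  obtain ⟨T', hT'⟩ := eventually_atTop.mp hs
  set T := max T' 1
  have hT1 : 1 ≤ T := le_max_right _ _
  have hT : ∀ t, T ≤ t → A.SmallSizes t := fun t ht => hT' t ((le_max_left _ _).trans ht)
  set κ := A.functionalRate μ c₁ c₂ j
  set C2 := (c₁ + c₂ + κ) ^ 2 with hC2
  set K := (A.law T).expect fun G => |functional c₁ c₂ j G - κ * T|
  have hlim : Tendsto (fun t : ℕ => (1 + C2 / 2) * (t : ℝ) ^ (-(1 / 4) : ℝ) + K / t)
      atTop (𝓝 0) := by
    have h1 : Tendsto (fun t : ℕ => (t : ℝ) ^ (-(1 / 4) : ℝ)) atTop (𝓝 0) :=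
      (tendsto_rpow_neg_atTop (by norm_num)).comp tendsto_natCast_atTop_atTop
    simpa using (h1.const_mul (1 + C2 / 2)).add (tendsto_const_div_atTop_nhds_zero_nat K)
  refine squeeze_zero' (Eventually.of_forall fun t => ?_) ?_ hlim
  · exact div_nonneg (PMF.expect_nonneg fun G _ => abs_nonneg _) (Nat.cast_nonneg _)
  · filter_upwards [eventually_ge_atTop T] with t ht
    have ht0 : (0 : ℝ) < t := by exact_mod_cast (Nat.lt_of_lt_of_le Nat.zero_lt_one (hT1.trans ht))
    -- The exponent balances the smoothing cost `M` against the accumulated error, of order `t *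
    -- t^(1/2) / M`.
    have hM : (0 : ℝ) < (t : ℝ) ^ (3 / 4 : ℝ) := by positivity
    set M := (t : ℝ) ^ (3 / 4 : ℝ) with hMdef
    have h1 : ((A.law t).expect fun G => |functional c₁ c₂ j G - κ * t|) ≤
        (A.law t).expect fun G => √(M ^ 2 + (functional c₁ c₂ j G - κ * t) ^ 2) :=
      PMF.expect_mono (A.hasExpect_functional_sub μ hmean j t _).abs
        (A.hasExpect_sqrt μ hmean j t hM _) fun G _ => abs_le_sqrt_sq_add _ _
    have h2 := A.expect_sqrt_le μ hmean hc₁ hc₂ j hT1 hT hM ht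
    -- Here `T` is fixed while `M` grows with `t`; `K` is a finite first moment that does not depend
    -- on `t`.
    have h3 : ((A.law T).expect fun G => √(M ^ 2 + (functional c₁ c₂ j G - κ * T) ^ 2)) ≤
        M + K := by
      have h4 := A.hasExpect_functional_sub μ hmean (c₁ := c₁) (c₂ := c₂) j T (κ * T)
      refine (PMF.expect_mono (A.hasExpect_sqrt μ hmean j T hM _)
        ((PMF.hasExpect_const _ M).add h4.abs) fun G _ => sqrt_sq_add_le_add_abs hM.le _).trans ?_
      rw [PMF.expect_add (PMF.hasExpect_const _ M) h4.abs, PMF.expect_const]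
    have h5 := h1.trans (h2.trans (add_le_add_left h3 _))
    set τ := (t : ℝ) ^ (-(1 / 4) : ℝ) with hτ
    have e1 : M = t * τ := by
      rw [hMdef, hτ]
      nth_rewrite 2 [← Real.rpow_one (t : ℝ)]
      rw [← Real.rpow_add ht0]
      norm_num
    have e2 : (t : ℝ) ^ (1 / 2 : ℝ) = M * τ := by
      rw [hMdef, hτ, ← Real.rpow_add ht0]
      norm_num
    rw [div_le_iff₀ ht0]
    refine h5.trans (le_of_eq ?_)
    rw [e2, ← hC2]
    have e3 : (t : ℝ) * (C2 * (M * τ) / (2 * M)) = t * (C2 / 2 * τ) := by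
      field_simp
    rw [e3, e1]
    field_simp
    ring

end Concentration

end CommunityModel

/-! ### Expansion of binomial means for a small success probability -/

/-- The expectation of `f (d + B)`, where `B` is binomial with parameters `n` and `q`. -/
def binomialMean (q : ℝ) (f : ℕ → ℝ) : ℕ → ℕ → ℝ
  | 0, d => f d
  | n + 1, d => (1 - q) * binomialMean q f n d + q * binomialMean q f n (d + 1)

section BinomialMean

variable {q : ℝ} {f : ℕ → ℝ} (h0 : 0 ≤ q) (h1 : q ≤ 1) (hf0 : ∀ n, 0 ≤ f n) (hf1 : ∀ n, f n ≤ 1)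
include h0 h1 hf0 hf1

theorem binomialMean_mem (n d : ℕ) : 0 ≤ binomialMean q f n d ∧ binomialMean q f n d ≤ 1 := by
  induction n generalizing d with
  | zero => exact ⟨hf0 d, hf1 d⟩
  | succ n ih =>
    obtain ⟨a, b⟩ := ih d
    obtain ⟨a', b'⟩ := ih (d + 1)
    rw [binomialMean]
    constructor <;> nlinarith

/-- Nothing changes unless some trial succeeds, which has probability at most `n q`. -/
theorem abs_binomialMean_sub_le (n d : ℕ) : |binomialMean q f n d - f d| ≤ n * q := by
  induction n with
  | zero => simp [binomialMean]
  | succ n ih =>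
    obtain ⟨a, b⟩ := binomialMean_mem h0 h1 hf0 hf1 n d
    obtain ⟨a', b'⟩ := binomialMean_mem h0 h1 hf0 hf1 n (d + 1)
    have e : binomialMean q f (n + 1) d - f d = (binomialMean q f n d - f d) +
        q * (binomialMean q f n (d + 1) - binomialMean q f n d) := by rw [binomialMean]; ring
    have h2 : |q * (binomialMean q f n (d + 1) - binomialMean q f n d)| ≤ q * 1 := by
      rw [abs_mul, abs_of_nonneg h0]
      exact mul_le_mul_of_nonneg_left (abs_le.mpr ⟨by linarith, by linarith⟩) h0
    rw [e]
    refine (abs_add_le _ _).trans ?_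
    push_cast
    linarith

/-- Only two or more successes escape the linear term. In the induction each trial adds at most `2 n
q²`, by the zeroth-order bound at `d` and at `d + 1`, and `n² + 2 n ≤ (n + 1)²`. -/
theorem abs_binomialMean_sub_linear_le (n d : ℕ) :
    |binomialMean q f n d - f d - n * q * (f (d + 1) - f d)| ≤ n ^ 2 * q ^ 2 := by
  induction n with
  | zero => simp [binomialMean]
  | succ n ih =>
    have a := abs_binomialMean_sub_le h0 h1 hf0 hf1 n d
    have a' := abs_binomialMean_sub_le h0 h1 hf0 hf1 n (d + 1)
    have e : binomialMean q f (n + 1) d - f d - (n + 1 : ℕ) * q * (f (d + 1) - f d) =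
        (binomialMean q f n d - f d - n * q * (f (d + 1) - f d)) +
        q * ((binomialMean q f n (d + 1) - f (d + 1)) - (binomialMean q f n d - f d)) := by
      rw [binomialMean]; push_cast; ring
    have h2 : |q * ((binomialMean q f n (d + 1) - f (d + 1)) - (binomialMean q f n d - f d))| ≤
        q * (2 * (n * q)) := by
      rw [abs_mul, abs_of_nonneg h0]
      refine mul_le_mul_of_nonneg_left ((abs_sub _ _).trans ?_) h0
      linarith
    rw [e]
    refine (abs_add_le _ _).trans ?_
    push_cast
    nlinarith [sq_nonneg q]

end BinomialMean

/-- Degrees never decrease: a vertex beyond degree `k` is irrelevant for the count at `k`, however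
large its weight. -/
theorem binomialMean_eq_zero {q : ℝ} {f : ℕ → ℝ} {k : ℕ} (hf : ∀ n, k < n → f n = 0) (n d : ℕ)
    (hd : k < d) : binomialMean q f n d = 0 := by
  induction n generalizing d with
  | zero => exact hf d hd
  | succ n ih => rw [binomialMean, ih d hd, ih (d + 1) (by omega)]; ring

/-- The multiplicity of `u` among independent samples is binomial with success probability `q u`;
the induction conditions on the first sample. -/
theorem PMF.expect_iidMultiset {α : Type} [DecidableEq α] (q : PMF α) (u : α) (f : ℕ → ℝ)
    (hf0 : ∀ n, 0 ≤ f n) (hf1 : ∀ n, f n ≤ 1) (n d : ℕ) :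
    ((q.iidMultiset n).expect fun e => f (d + e.count u)) =
      binomialMean (q u).toReal f n d := by
  have hb : ∀ (p : PMF (Multiset α)) (d : ℕ), p.HasExpect fun e => f (d + e.count u) :=
    fun p d => PMF.hasExpect_of_bounded 1 fun e _ => by
      rw [abs_of_nonneg (hf0 _)]; exact hf1 _
  induction n generalizing d with
  | zero => simp [iidMultiset, PMF.expect_pure, binomialMean]
  | succ n ih =>
    have hbd := hb (q.iidMultiset (n + 1)) d
    rw [iidMultiset] at hbd ⊢
    rw [PMF.expect_bind hbd]
    have e : ∀ a, ((q.iidMultiset n).map fun e => a ::ₘ e).expect (fun e => f (d + e.count u)) =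
        binomialMean (q u).toReal f n d + (if a = u then 1 else 0) *
          (binomialMean (q u).toReal f n (d + 1) - binomialMean (q u).toReal f n d) := by
      intro a
      by_cases ha : a = u
      · subst ha
        have h := hb (q.iidMultiset n) (d + 1)
        have c : ∀ e : Multiset α, f (d + (a ::ₘ e).count a) = f (d + 1 + e.count a) := fun e => by
          rw [Multiset.count_cons_self]; congr 1; omega
        rw [PMF.expect_map (by simpa only [c] using h)]
        simp only [c, ih, if_true]
        ring
      · have h := hb (q.iidMultiset n) d
        have c : ∀ e : Multiset α, f (d + (a ::ₘ e).count u) = f (d + e.count u) := fun e => by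
          rw [Multiset.count_cons_of_ne (Ne.symm ha)]
        rw [PMF.expect_map (by simpa only [c] using h)]
        simp only [c, ih, if_neg ha]
        ring
    simp only [e]
    have hi : q.HasExpect fun a => if a = u then (1 : ℝ) else 0 :=
      PMF.hasExpect_of_bounded 1 fun a _ => by split_ifs <;> simp
    have hi' : (q.expect fun a => if a = u then (1 : ℝ) else 0) = (q u).toReal := by
      rw [PMF.expect, tsum_eq_single u]
      · simp
      · intro b hb; simp [hb]
    simp only [mul_comm (ite _ _ _)]
    rw [PMF.expect_add (PMF.hasExpect_const _ _) (hi.const_mul _), PMF.expect_const,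
      PMF.expect_const_mul, hi', binomialMean]
    ring

/-! ### Expected change of the degree counts in one step -/

namespace CommunityModel

variable {r d : ℕ} [NeZero r] (A : CommunityModel r d)

theorem expect_newEdge (G : CommunityHypergraph r) (S : Finset (Fin r)) (x : Fin r → ℕ)
    (u : Fin G.size) {f : ℕ → ℝ} (hf0 : ∀ n, 0 ≤ f n) (hf1 : ∀ n, f n ≤ 1) :
    ((A.newEdge G S x).expect fun e => f (G.degree u + e.count u)) =
      if G.comm u ∈ S then (∑ i, binomialMean ((G.degree u + A.γ) / G.commWeight A.γ (G.comm u)) f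
        (x i) (G.degree u)) / r else f (G.degree u) := by
  have hb : ∀ q : PMF ℕ, q.HasExpect fun n => f (G.degree u + n) :=
    fun q => PMF.hasExpect_of_bounded 1 fun n _ => by rw [abs_of_nonneg (hf0 _)]; exact hf1 _
  have hb' : ∀ q : PMF (Multiset (Fin G.size)), q.HasExpect fun e => f (G.degree u + e.count u) :=
    fun q => PMF.hasExpect_of_bounded 1 fun n _ => by rw [abs_of_nonneg (hf0 _)]; exact hf1 _
  have e := A.map_newEdge G S x (G.comm u) (Multiset.countAddMonoidHom u) fun v hv => by
    rw [Multiset.coe_countAddMonoidHom, Multiset.count_singleton, if_neg]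
    rintro rfl
    exact hv rfl
  have e1 := PMF.expect_map (q := A.newEdge G S x) (g := Multiset.countAddMonoidHom u)
    (f := fun n => f (G.degree u + n)) (by simpa using hb' _)
  simp only [Multiset.coe_countAddMonoidHom] at e e1
  rw [← e1, e]
  split_ifs
  · rw [PMF.expect_bind (hb _), PMF.expect_uniformOfFintype, Fintype.card_fin]
    congr 1
    refine Finset.sum_congr rfl fun i _ => ?_
    rw [PMF.expect_map (f := fun n => f (G.degree u + n)) (hb' _), PMF.expect_iidMultiset _ _ _ hf0 hf1, G.choose_toReal]
  · rw [PMF.expect_pure, add_zero]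

set_option linter.deprecated false in
theorem expect_step {t : ℕ} {G : CommunityHypergraph r} {f : CommunityHypergraph r → ℝ}
    (hf : (A.step t G).HasExpect f) : (A.step t G).expect f =
      A.p * (A.M.expect fun i => f (G.addVertex i)) + (1 - A.p) * A.P.toPMF.expect fun S =>
        (A.X t).expect fun x => (A.newEdge G S x).expect fun e => f (G.addEdge e) := by
  rw [step] at hf ⊢
  have key : ∀ b ∈ (PMF.bernoulli A.p A.p_lt_one.le).support,
      (if b = true then A.M.map G.addVertex else A.P.toPMF.bind fun S => (A.X t).bind fun x =>
        (A.newEdge G S x).map G.addEdge).expect f =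
      if b = true then A.M.expect fun i => f (G.addVertex i) else A.P.toPMF.expect fun S =>
        (A.X t).expect fun x => (A.newEdge G S x).expect fun e => f (G.addEdge e) := by
    intro b hb
    have h := PMF.hasExpect_of_mem_support_bind hf hb
    cases b
    · simp only [Bool.false_eq_true, if_false] at h ⊢
      rw [PMF.expect_bind h]
      refine PMF.expect_congr fun S hS => ?_
      have h' := PMF.hasExpect_of_mem_support_bind h hS
      rw [PMF.expect_bind h']
      refine PMF.expect_congr fun x hx => ?_
      exact PMF.expect_map (PMF.hasExpect_map.mp (PMF.hasExpect_of_mem_support_bind h' hx))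
    · simp only [if_true] at h ⊢
      exact PMF.expect_map (PMF.hasExpect_map.mp h)
  rw [PMF.expect_bind hf, PMF.expect_congr key, PMF.expect_bernoulli]
  simp

omit [NeZero r] in
theorem expect_ite_share (j : Fin r) (a b : ℝ) :
    (A.P.toPMF.expect fun S => if j ∈ S then a else b) = b + (A.P.share j).toReal * (a - b) := by
  have e : ∀ S : Finset (Fin r), (if j ∈ S then a else b) = b + (a - b) * if j ∈ S then 1 else 0 :=
    fun S => by split_ifs <;> ring
  simp only [e]
  rw [PMF.expect_add (PMF.hasExpect_fintype _ _) (PMF.hasExpect_fintype _ _), PMF.expect_const,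
    PMF.expect_const_mul, PMF.expect_fintype, HyperedgeMatrix.share,
    ENNReal.toReal_sum fun S _ => PMF.apply_ne_top _ _, Finset.sum_filter]
  simp only [mul_ite, mul_one, mul_zero]
  ring

/-- The mean of `∑ f (deg v)` over community `j` after the addition of an edge that selects this
community, with cardinalities `x`. -/
def edgeMean (G : CommunityHypergraph r) (j : Fin r) (f : ℕ → ℝ) (x : Fin r → ℕ) : ℝ :=
  (∑ i, ∑ u ∈ Finset.univ.filter (fun u => G.comm u = j),
    binomialMean ((G.degree u + A.γ) / G.commWeight A.γ j) f (x i) (G.degree u)) / r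

theorem expect_newEdge_commSum (G : CommunityHypergraph r) (S : Finset (Fin r)) (x : Fin r → ℕ)
    (j : Fin r) {f : ℕ → ℝ} (hf0 : ∀ n, 0 ≤ f n) (hf1 : ∀ n, f n ≤ 1) :
    ((A.newEdge G S x).expect fun e => (G.addEdge e).commSum j f) =
      if j ∈ S then A.edgeMean G j f x else G.commSum j f := by
  simp only [G.commSum_addEdge]
  rw [PMF.expect_sum _ fun u _ => PMF.hasExpect_of_bounded 1 fun n _ => by
    rw [abs_of_nonneg (hf0 _)]; exact hf1 _]
  have e : ∀ u ∈ Finset.univ.filter (fun u => G.comm u = j),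
      ((A.newEdge G S x).expect fun e => f (G.degree u + e.count u)) =
      if j ∈ S then (∑ i, binomialMean ((G.degree u + A.γ) / G.commWeight A.γ j) f
        (x i) (G.degree u)) / r else f (G.degree u) := by
    intro u hu
    rw [A.expect_newEdge G S x u hf0 hf1, (Finset.mem_filter.mp hu).2]
  rw [Finset.sum_congr rfl e]
  split_ifs
  · rw [← Finset.sum_div, Finset.sum_comm]
    rfl
  · rfl

omit [NeZero r] in
theorem commSum_mem (G : CommunityHypergraph r) (j : Fin r) {f : ℕ → ℝ} (hf0 : ∀ n, 0 ≤ f n)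
    (hf1 : ∀ n, f n ≤ 1) : 0 ≤ G.commSum j f ∧ G.commSum j f ≤ G.commSize j := by
  refine ⟨Finset.sum_nonneg fun u _ => hf0 _, ?_⟩
  rw [CommunityHypergraph.commSize, Finset.cast_card]
  exact Finset.sum_le_sum fun u _ => hf1 _

theorem hasExpect_step_commSum (t : ℕ) (G : CommunityHypergraph r) (j : Fin r) {f : ℕ → ℝ}
    (hf0 : ∀ n, 0 ≤ f n) (hf1 : ∀ n, f n ≤ 1) :
    (A.step t G).HasExpect fun G' => G'.commSum j f := by
  have h := (A.expect_step_of_increment t G j (fun a _ => (a : ℝ)) (by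
    push_cast
    exact (PMF.hasExpect_const _ _).add (A.hasExpect_increment_fst t j))).1
  refine h.mono fun G' _ => ?_
  obtain ⟨a, b⟩ := commSum_mem G' j hf0 hf1
  rwa [abs_of_nonneg a]

theorem expect_step_commSum (t : ℕ) (G : CommunityHypergraph r) (j : Fin r) {f : ℕ → ℝ}
    (hf0 : ∀ n, 0 ≤ f n) (hf1 : ∀ n, f n ≤ 1) :
    ((A.step t G).expect fun G' => G'.commSum j f) = G.commSum j f + A.vertexRate j * f 0 +
      (1 - A.p) * (A.P.share j).toReal * ((A.X t).expect (A.edgeMean G j f) - G.commSum j f) := by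
  rw [A.expect_step (A.hasExpect_step_commSum t G j hf0 hf1)]
  have e1 : (A.M.expect fun i => (G.addVertex i).commSum j f) =
      G.commSum j f + (A.M j).toReal * f 0 := by
    simp only [G.commSum_addVertex]
    rw [PMF.expect_add (PMF.hasExpect_const _ _) (PMF.hasExpect_fintype _ _), PMF.expect_const,
      PMF.expect_fintype]
    simp
  have e2 : ∀ S : Finset (Fin r), ((A.X t).expect fun x =>
      (A.newEdge G S x).expect fun e => (G.addEdge e).commSum j f) =
      if j ∈ S then (A.X t).expect (A.edgeMean G j f) else G.commSum j f := by
    intro S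
    simp only [A.expect_newEdge_commSum G S _ j hf0 hf1]
    split_ifs
    · rfl
    · rw [PMF.expect_const]
  rw [e1]
  simp only [e2]
  rw [A.expect_ite_share, vertexRate]
  ring

/-- The indicator of `k`. -/
def indicatorAt (k n : ℕ) : ℝ := if n = k then 1 else 0

theorem indicatorAt_nonneg (k n : ℕ) : 0 ≤ indicatorAt k n := by
  unfold indicatorAt; split_ifs <;> simp

theorem indicatorAt_le_one (k n : ℕ) : indicatorAt k n ≤ 1 := by
  unfold indicatorAt; split_ifs <;> simp

/-- The number of vertices of degree `k` in community `j`. -/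
def commDegree (j : Fin r) (k : ℕ) (G : CommunityHypergraph r) : ℝ := G.commSum j (indicatorAt k)

/-- The total weight of the vertices of degree `k - 1` in community `j`. -/
def prevWeight (γ : ℝ) (j : Fin r) (G : CommunityHypergraph r) : ℕ → ℝ
  | 0 => 0
  | k + 1 => (k + γ) * commDegree j k G

omit [NeZero r] in
theorem weight_mul_commDegree (γ : ℝ) (j : Fin r) (k : ℕ) (G : CommunityHypergraph r) :
    (k + γ) * commDegree j k G = G.commSum j fun n => (n + γ) * indicatorAt k n := by
  rw [commDegree, CommunityHypergraph.commSum, Finset.mul_sum]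
  refine Finset.sum_congr rfl fun u _ => ?_
  simp only [indicatorAt]
  split_ifs with h
  · rw [h]
  · simp

omit [NeZero r] in
theorem weight_mul_commDegree_mem {γ : ℝ} (hγ : 0 ≤ γ) (j : Fin r) (k : ℕ)
    (G : CommunityHypergraph r) :
    0 ≤ (k + γ) * commDegree j k G ∧ (k + γ) * commDegree j k G ≤ G.commWeight γ j := by
  rw [weight_mul_commDegree, CommunityHypergraph.commWeight_eq_sum]
  refine ⟨Finset.sum_nonneg fun u _ => mul_nonneg (by positivity) (indicatorAt_nonneg _ _),
    Finset.sum_le_sum fun u _ => mul_le_of_le_one_right (by positivity) (indicatorAt_le_one _ _)⟩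

omit [NeZero r] in
theorem prevWeight_mem {γ : ℝ} (hγ : 0 ≤ γ) (j : Fin r) (k : ℕ) (G : CommunityHypergraph r) :
    0 ≤ prevWeight γ j G k ∧ prevWeight γ j G k ≤ G.commWeight γ j := by
  cases k with
  | zero => exact ⟨le_rfl, (G.commWeight_pos hγ j).le⟩
  | succ k => exact weight_mul_commDegree_mem hγ j k G

omit [NeZero r] in
-- The shifted indicator treats all `k` alike: for `k = 0` it vanishes, as no vertex enters degree
-- zero by gaining degree.
theorem prevWeight_eq_sum (γ : ℝ) (j : Fin r) (k : ℕ) (G : CommunityHypergraph r) :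
    prevWeight γ j G k = G.commSum j fun n => (n + γ) * indicatorAt k (n + 1) := by
  cases k with
  | zero => simp [prevWeight, CommunityHypergraph.commSum, indicatorAt]
  | succ k =>
    rw [prevWeight, weight_mul_commDegree]
    simp [indicatorAt]

omit [NeZero r] in
-- The linear terms of the binomial expansions add up to inflow minus outflow at degree `k`. The
-- selection probabilities sum to one, so a remainder of the form (constant) times `q u` is enough.
-- The bound with `2` is valid for every weight, while the other is small when the weight is large;
-- both are kept because the weight is random.
theorem sum_binomialMean_sub_le (G : CommunityHypergraph r) {γ : ℝ} (hγ : 0 ≤ γ) (j : Fin r)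
    (k n : ℕ) {τ : ℝ} (hn : (n : ℝ) ≤ τ) :
    |(∑ u ∈ Finset.univ.filter (fun u => G.comm u = j),
      binomialMean ((G.degree u + γ) / G.commWeight γ j) (indicatorAt k) n (G.degree u)) -
      commDegree j k G - n * ((prevWeight γ j G k - (k + γ) * commDegree j k G) /
        G.commWeight γ j)| ≤ n * min 2 (τ * (k + γ) / G.commWeight γ j) := by
  set D := G.commWeight γ j with hD
  have hD0 : 0 < D := G.commWeight_pos hγ j
  set s := Finset.univ.filter (fun u => G.comm u = j) with hs
  set f := indicatorAt k with hf
  let q : Fin G.size → ℝ := fun u => (G.degree u + γ) / D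
  have hq0 : ∀ u, 0 ≤ q u := fun u => by positivity
  have hqs : ∑ u ∈ s, q u = 1 := by
    rw [← Finset.sum_div, div_eq_one_iff_eq hD0.ne', hD, G.commWeight_eq_sum]
    rfl
  have hq1 : ∀ u ∈ s, q u ≤ 1 := fun u hu => by
    rw [← hqs]
    exact Finset.single_le_sum (fun v _ => hq0 v) hu
  have hR : (prevWeight γ j G k - (k + γ) * commDegree j k G) / D =
      ∑ u ∈ s, q u * (f (G.degree u + 1) - f (G.degree u)) := by
    rw [prevWeight_eq_sum, weight_mul_commDegree, CommunityHypergraph.commSum,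
      CommunityHypergraph.commSum, ← Finset.sum_sub_distrib, Finset.sum_div]
    refine Finset.sum_congr rfl fun u _ => ?_
    simp only [q]
    ring
  have e : (∑ u ∈ s, binomialMean (q u) f n (G.degree u)) - commDegree j k G -
      n * ((prevWeight γ j G k - (k + γ) * commDegree j k G) / D) =
      ∑ u ∈ s, (binomialMean (q u) f n (G.degree u) - f (G.degree u) -
        n * q u * (f (G.degree u + 1) - f (G.degree u))) := by
    rw [hR, Finset.sum_sub_distrib, Finset.sum_sub_distrib, Finset.mul_sum]
    simp only [mul_assoc]
    rfl
  refine (congrArg abs e).le.trans ((Finset.abs_sum_le_sum_abs _ _).trans ?_)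
  have hn0 : (0 : ℝ) ≤ n := Nat.cast_nonneg n
  rw [mul_min_of_nonneg _ _ hn0]
  refine le_min ?_ ?_
  · have b : ∀ u ∈ s, |binomialMean (q u) f n (G.degree u) - f (G.degree u) -
        n * q u * (f (G.degree u + 1) - f (G.degree u))| ≤ (n * 2) * q u := by
      intro u hu
      have h1 := abs_binomialMean_sub_le (hq0 u) (hq1 u hu) (indicatorAt_nonneg k)
        (indicatorAt_le_one k) n (G.degree u)
      have h2 : |(n : ℝ) * q u * (f (G.degree u + 1) - f (G.degree u))| ≤ n * q u * 1 := by
        rw [abs_mul, abs_of_nonneg (mul_nonneg hn0 (hq0 u))]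
        refine mul_le_mul_of_nonneg_left (abs_le.mpr ⟨?_, ?_⟩) (mul_nonneg hn0 (hq0 u))
        · linarith [indicatorAt_nonneg k (G.degree u + 1), indicatorAt_le_one k (G.degree u)]
        · linarith [indicatorAt_nonneg k (G.degree u), indicatorAt_le_one k (G.degree u + 1)]
      refine (abs_sub _ _).trans ?_
      linarith
    refine (Finset.sum_le_sum b).trans ?_
    rw [← Finset.mul_sum, hqs, mul_one]
  · have b : ∀ u ∈ s, |binomialMean (q u) f n (G.degree u) - f (G.degree u) -
        n * q u * (f (G.degree u + 1) - f (G.degree u))| ≤ (n * (τ * (k + γ) / D)) * q u := by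
      intro u hu
      -- Above `k` every term vanishes; otherwise the selection probability is at most `(k + γ) /
      -- D`, uniformly in `u`.
      by_cases hk : k < G.degree u
      · have z : ∀ m, k < m → f m = 0 := fun m hm => if_neg hm.ne'
        rw [binomialMean_eq_zero z n _ hk, z _ hk, z _ (Nat.lt_succ_of_lt hk)]
        simp only [sub_self, mul_zero, abs_zero]
        have : 0 ≤ τ := hn0.trans hn
        have := hq0 u
        positivity
      · refine (abs_binomialMean_sub_linear_le (hq0 u) (hq1 u hu) (indicatorAt_nonneg k)
          (indicatorAt_le_one k) n (G.degree u)).trans ?_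
        have hdk : (G.degree u : ℝ) ≤ k := by exact_mod_cast not_lt.mp hk
        have h3 : q u ≤ (k + γ) / D := div_le_div_of_nonneg_right (by linarith) hD0.le
        have h4 : n * q u ≤ τ * ((k + γ) / D) := by
          exact mul_le_mul hn h3 (hq0 u) (hn0.trans hn)
        have h5 := mul_le_mul_of_nonneg_left h4 (mul_nonneg hn0 (hq0 u))
        calc (n : ℝ) ^ 2 * q u ^ 2 = n * q u * (n * q u) := by ring
          _ ≤ n * q u * (τ * ((k + γ) / D)) := h5
          _ = n * (τ * (k + γ) / D) * q u := by ring
    refine (Finset.sum_le_sum b).trans ?_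
    rw [← Finset.mul_sum, hqs, mul_one]

theorem abs_edgeMean_sub_le (G : CommunityHypergraph r) (j : Fin r) (k : ℕ) {τ : ℝ}
    (x : Fin r → ℕ) (hx : ∀ i, (x i : ℝ) ≤ τ) :
    |A.edgeMean G j (indicatorAt k) x - (commDegree j k G + ((prevWeight A.γ j G k -
      (k + A.γ) * commDegree j k G) / G.commWeight A.γ j) * ((∑ i, (x i : ℝ)) / r))| ≤
      min 2 (τ * (k + A.γ) / G.commWeight A.γ j) * ((∑ i, (x i : ℝ)) / r) := by
  have hr : (0 : ℝ) < r := by exact_mod_cast Nat.pos_of_ne_zero (NeZero.ne r)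
  set R := (prevWeight A.γ j G k - (k + A.γ) * commDegree j k G) / G.commWeight A.γ j
  set m := min 2 (τ * (k + A.γ) / G.commWeight A.γ j)
  have e : A.edgeMean G j (indicatorAt k) x - (commDegree j k G + R * ((∑ i, (x i : ℝ)) / r)) =
      (∑ i, ((∑ u ∈ Finset.univ.filter (fun u => G.comm u = j),
      binomialMean ((G.degree u + A.γ) / G.commWeight A.γ j) (indicatorAt k) (x i) (G.degree u)) -
      commDegree j k G - x i * R)) / r := by
    rw [edgeMean, Finset.sum_sub_distrib, Finset.sum_sub_distrib, Finset.sum_const,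
      Finset.card_univ, Fintype.card_fin, nsmul_eq_mul, ← Finset.sum_mul]
    field_simp
    ring
  rw [e, abs_div, abs_of_pos hr, ← mul_div_assoc, Finset.mul_sum]
  refine div_le_div_of_nonneg_right ((Finset.abs_sum_le_sum_abs _ _).trans
    (Finset.sum_le_sum fun i _ => ?_)) hr.le
  rw [mul_comm m]
  exact sum_binomialMean_sub_le G A.γ.coe_nonneg j k (x i) (hx i)

variable (μ : Fin r → ℝ≥0) (hmean : ∀ t i, (A.X t).mean (fun x => (x i : ℝ≥0∞)) = μ i)
include hmean

omit [NeZero r] in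
theorem hasExpect_size (t : ℕ) (i : Fin r) : (A.X t).HasExpect fun x => (x i : ℝ) := by
  rw [PMF.hasExpect_iff]
  simp only [Nat.abs_cast, ENNReal.ofReal_natCast, hmean]
  exact ENNReal.coe_ne_top

omit [NeZero r] in
theorem expect_size (t : ℕ) (i : Fin r) : ((A.X t).expect fun x => (x i : ℝ)) = μ i := by
  rw [PMF.expect_of_nonneg _ fun n => Nat.cast_nonneg _]
  simp only [ENNReal.ofReal_natCast, hmean, ENNReal.coe_toReal]

/-- The approximate rate equation, conditional on `G`. The error is proportional to the mean size
and not to its square, since one of the two factors of the size was bounded by `t^(1/4)`. -/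
theorem abs_expect_step_commDegree_sub_le {t : ℕ} (hs : A.SmallSizes t)
    (G : CommunityHypergraph r) (j : Fin r) (k : ℕ) :
    |((A.step t G).expect (commDegree j k)) - (commDegree j k G + A.vertexRate j * indicatorAt k 0 +
      A.degreeRate μ j * ((prevWeight A.γ j G k - (k + A.γ) * commDegree j k G) /
        G.commWeight A.γ j))| ≤
      A.degreeRate μ j * min 2 ((t : ℝ) ^ (1 / 4 : ℝ) * (k + A.γ) / G.commWeight A.γ j) := by
  set R := (prevWeight A.γ j G k - (k + A.γ) * commDegree j k G) / G.commWeight A.γ j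
  set m := min 2 ((t : ℝ) ^ (1 / 4 : ℝ) * (k + A.γ) / G.commWeight A.γ j)
  have hX : (A.X t).HasExpect fun x => (∑ i, (x i : ℝ)) / r := by
    have := (PMF.HasExpect.sum Finset.univ fun i _ => A.hasExpect_size μ hmean t i).const_mul
      (r : ℝ)⁻¹
    simpa only [div_eq_inv_mul] using this
  have hX' : ((A.X t).expect fun x => (∑ i, (x i : ℝ)) / r) = (∑ i, (μ i : ℝ)) / r := by
    simp only [div_eq_inv_mul]
    rw [PMF.expect_const_mul, PMF.expect_sum _ fun i _ => A.hasExpect_size μ hmean t i]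
    simp only [A.expect_size μ hmean]
  have hpt : ∀ x ∈ (A.X t).support, |A.edgeMean G j (indicatorAt k) x -
      (commDegree j k G + R * ((∑ i, (x i : ℝ)) / r))| ≤ m * ((∑ i, (x i : ℝ)) / r) :=
    fun x hx => A.abs_edgeMean_sub_le G j k x fun i => (hs x hx i).le
  have hlin := (PMF.hasExpect_const (A.X t) (commDegree j k G)).add (hX.const_mul R)
  have hedge : (A.X t).HasExpect (A.edgeMean G j (indicatorAt k)) := by
    refine ((hX.const_mul m).add hlin.abs).mono fun x hx => ?_
    have := hpt x hx
    have h2 := abs_sub_abs_le_abs_sub (A.edgeMean G j (indicatorAt k) x)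
      (commDegree j k G + R * ((∑ i, (x i : ℝ)) / r))
    linarith
  have h := PMF.abs_expect_sub_le hedge hlin (hX.const_mul m) hpt
  rw [PMF.expect_add (PMF.hasExpect_const _ _) (hX.const_mul R), PMF.expect_const,
    PMF.expect_const_mul, PMF.expect_const_mul, hX'] at h
  have e := A.expect_step_commSum t G j (indicatorAt_nonneg k) (indicatorAt_le_one k)
  change (A.step t G).expect (commDegree j k) = commDegree j k G + _ + _ * (_ - commDegree j k G)
    at e
  rw [e, degreeRate]
  set σ := (1 - (A.p : ℝ)) * (A.P.share j).toReal
  have hσ : 0 ≤ σ := mul_nonneg (by linarith [A.p_real_lt_one]) ENNReal.toReal_nonneg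
  have e2 : commDegree j k G + A.vertexRate j * indicatorAt k 0 + σ *
      ((A.X t).expect (A.edgeMean G j (indicatorAt k)) - commDegree j k G) -
      (commDegree j k G + A.vertexRate j * indicatorAt k 0 +
        σ * ((∑ i, (μ i : ℝ)) / r) * R) =
      σ * ((A.X t).expect (A.edgeMean G j (indicatorAt k)) -
        (commDegree j k G + R * ((∑ i, (μ i : ℝ)) / r))) := by ring
  rw [e2, abs_mul, abs_of_nonneg hσ, mul_assoc σ]
  refine mul_le_mul_of_nonneg_left (h.trans (le_of_eq (mul_comm _ _))) hσ

end CommunityModel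

/-! ### Real analysis: the recurrence and its stationary solution -/

/-- With `L = c / (1 + b)` the line `L t` solves the recurrence exactly. The deviation from it is
multiplied by `1 - b / t`, which eventually lies in `[0, 1]`, so it is at most a constant plus the
sum of the `|ε s|`, and Cesàro means make this `o(t)`. -/
theorem tendsto_div_of_recurrence {a ε : ℕ → ℝ} {b c : ℝ} (hb : 0 ≤ b)
    (hε : Tendsto ε atTop (𝓝 0))
    (h : ∀ᶠ t : ℕ in atTop, |a (t + 1) - ((1 - b / t) * a t + c)| ≤ ε t) :
    Tendsto (fun t => a t / t) atTop (𝓝 (c / (1 + b))) := by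
  obtain ⟨T', hT'⟩ := eventually_atTop.mp h
  obtain ⟨B, hB⟩ := exists_nat_ge b
  -- Beyond `B ≥ b` the factor `1 - b / t` is nonnegative; the `1` keeps `t` positive.
  set T := max T' (max B 1)
  set L := c / (1 + b) with hL
  have hLb : L * (1 + b) = c := div_mul_cancel₀ _ (by positivity)
  let x : ℕ → ℝ := fun t => a t - L * t
  have hx : ∀ t, T ≤ t → |x (t + 1)| ≤ |x t| + |ε t| := by
    intro t ht
    have h1 : 1 ≤ t := ((le_max_right _ _).trans (le_max_right _ _)).trans ht
    have h2 : B ≤ t := ((le_max_left _ _).trans (le_max_right _ _)).trans ht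
    have ht0 : (0 : ℝ) < t := by exact_mod_cast h1
    have hbt : b / t ≤ 1 := (div_le_one ht0).mpr (hB.trans (by exact_mod_cast h2))
    have hbt0 : 0 ≤ b / t := by positivity
    have e : x (t + 1) = (1 - b / t) * x t + (a (t + 1) - ((1 - b / t) * a t + c)) := by
      simp only [x]
      rw [← hLb]
      field_simp
      push_cast
      ring
    have h3 : |(1 - b / t) * x t| ≤ |x t| := by
      rw [abs_mul, abs_of_nonneg (by linarith)]
      exact mul_le_of_le_one_left (abs_nonneg _) (by linarith)
    rw [e]
    refine (abs_add_le _ _).trans (add_le_add h3 ?_)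
    exact (hT' t ((le_max_left _ _).trans ht)).trans (le_abs_self _)
  have hsum : ∀ t, T ≤ t → |x t| ≤ |x T| + ∑ s ∈ Finset.range t, |ε s| := by
    intro t ht
    induction t, ht using Nat.le_induction with
    | base => exact le_add_of_nonneg_right (Finset.sum_nonneg fun _ _ => abs_nonneg _)
    | succ t ht ih =>
      rw [Finset.sum_range_succ]
      linarith [hx t ht]
  have hlim : Tendsto (fun t : ℕ => |x T| / t + (t : ℝ)⁻¹ * ∑ s ∈ Finset.range t, |ε s|)
      atTop (𝓝 0) := by
    have h0 : Tendsto (fun t => |ε t|) atTop (𝓝 0) := by simpa using hε.abs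
    simpa using (tendsto_const_div_atTop_nhds_zero_nat |x T|).add h0.cesaro
  rw [tendsto_iff_dist_tendsto_zero]
  refine squeeze_zero' (Eventually.of_forall fun t => dist_nonneg) ?_ hlim
  filter_upwards [eventually_ge_atTop T] with t ht
  have h1 : 1 ≤ t := ((le_max_right _ _).trans (le_max_right _ _)).trans ht
  have ht0 : (0 : ℝ) < t := by exact_mod_cast h1
  have e : a t / t - L = x t / t := by simp only [x]; field_simp
  rw [Real.dist_eq, e, abs_div, abs_of_pos ht0, ← div_eq_inv_mul, ← add_div]
  exact div_le_div_of_nonneg_right (hsum t ht) ht0.le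

/-- The stationary solution of the recurrence for the numbers of vertices of given degree, where
vertices arrive at rate `v` and `θ` is the share of the degrees in the growth of the weight. -/
def degreeLimit (v θ γ : ℝ) : ℕ → ℝ
  | 0 => v / (1 + θ * γ)
  | k + 1 => θ * ((k + γ) * degreeLimit v θ γ k) / (1 + θ * ((k + 1 : ℕ) + γ))

theorem degreeLimit_zero_succ (v γ : ℝ) (k : ℕ) : degreeLimit v 0 γ (k + 1) = 0 := by
  simp [degreeLimit]

/-- Needed because `Real.GammaSeq` at `n` has `n + 1` factors in its denominator, while the power is
that of `n`. -/
theorem tendsto_mul_succ_rpow {u : ℕ → ℝ} {s C : ℝ}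
    (h : Tendsto (fun n : ℕ => u (n + 1) * (n : ℝ) ^ s) atTop (𝓝 C)) :
    Tendsto (fun n : ℕ => u n * (n : ℝ) ^ s) atTop (𝓝 C) := by
  rw [← tendsto_add_atTop_iff_nat 1]
  have h1 : Tendsto (fun n : ℕ => (1 + 1 / (n : ℝ)) ^ s) atTop (𝓝 1) := by
    have h0 : Tendsto (fun n : ℕ => 1 + 1 / (n : ℝ)) atTop (𝓝 1) := by
      simpa using (tendsto_const_nhds (x := (1 : ℝ))).add tendsto_one_div_atTop_nhds_zero_nat
    simpa using h0.rpow_const (p := s) (Or.inl one_ne_zero)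
  have h2 := h.mul h1
  rw [mul_one] at h2
  refine h2.congr' ?_
  filter_upwards [eventually_ge_atTop 1] with n hn
  have hn0 : (0 : ℝ) < n := by exact_mod_cast hn
  rw [mul_assoc, ← Real.mul_rpow hn0.le (by positivity)]
  congr 2
  push_cast
  field_simp

/-- Consecutive terms have ratio `(k + γ) / (k + b)` with `b = γ + 1 + 1/θ`. The resulting quotient
of products, times `n^(b - γ)`, is a quotient of Euler's approximations to `Γ(b)` and `Γ(γ)`. -/
theorem exists_tendsto_degreeLimit {v θ γ : ℝ} (hv : 0 < v) (hθ : 0 < θ) (hγ : 0 < γ) :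
    ∃ C : ℝ, 0 < C ∧
      Tendsto (fun k : ℕ => degreeLimit v θ γ k * (k : ℝ) ^ (1 + 1 / θ)) atTop (𝓝 C) := by
  set b := γ + (1 + 1 / θ) with hb
  have hb0 : 0 < b := by positivity
  have hprod : ∀ n : ℕ, degreeLimit v θ γ n = v / (1 + θ * γ) *
      ((∏ i ∈ Finset.range n, (γ + i)) / ∏ i ∈ Finset.range n, (b + i)) := by
    intro n
    induction n with
    | zero => simp [degreeLimit]
    | succ n ih =>
      rw [degreeLimit, ih, Finset.prod_range_succ, Finset.prod_range_succ]
      have h1 : 0 < ∏ i ∈ Finset.range n, (b + i) := Finset.prod_pos fun i _ => by positivity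
      have h2 : b + n ≠ 0 := by positivity
      have h3 : 1 + θ * ((n + 1 : ℕ) + γ) = θ * (b + n) := by
        rw [hb]; push_cast; field_simp; ring
      rw [h3]
      field_simp
      ring
  refine ⟨v / (1 + θ * γ) * (Real.Gamma b / Real.Gamma γ), ?_, tendsto_mul_succ_rpow ?_⟩
  · have := Real.Gamma_pos_of_pos hb0
    have := Real.Gamma_pos_of_pos hγ
    positivity
  · have h := ((Real.GammaSeq_tendsto_Gamma b).div (Real.GammaSeq_tendsto_Gamma γ)
      (Real.Gamma_pos_of_pos hγ).ne').const_mul (v / (1 + θ * γ))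
    refine h.congr' ?_
    filter_upwards [eventually_ge_atTop 1] with n hn
    have hn0 : (0 : ℝ) < n := by exact_mod_cast hn
    rw [hprod]
    simp only [Pi.div_apply, Real.GammaSeq]
    have h1 : 0 < ∏ i ∈ Finset.range (n + 1), (b + i) := Finset.prod_pos fun i _ => by positivity
    have h2 : 0 < ∏ i ∈ Finset.range (n + 1), (γ + i) := Finset.prod_pos fun i _ => by positivity
    have h3 : (0 : ℝ) < n.factorial := by exact_mod_cast n.factorial_pos
    have h4 : (n : ℝ) ^ b = (n : ℝ) ^ γ * (n : ℝ) ^ (1 + 1 / θ) := Real.rpow_add hn0 _ _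
    have h5 : (0 : ℝ) < (n : ℝ) ^ γ := by positivity
    rw [h4]
    field_simp

/-- Replacing a weight `D` by its approximation `E` changes the normalized flow by little. -/
theorem abs_div_weight_sub_le {x D E m δ : ℝ} (hD : 0 < D) (hE : 0 < E) (hx : |x| ≤ D)
    (hm : 0 ≤ m) (hδ : 0 ≤ δ) :
    δ * min 2 (m / D) + |δ * (x / D) - δ * (x / E)| ≤
      5 * δ / E * |D - E| + 2 * δ * m / E := by
  have h1 : |δ * (x / D) - δ * (x / E)| ≤ δ * (|D - E| / E) := by
    have e : δ * (x / D) - δ * (x / E) = δ * ((x / D) * ((E - D) / E)) := by field_simp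
    rw [e, abs_mul, abs_of_nonneg hδ, abs_mul, abs_div _ E, abs_of_pos hE, abs_sub_comm E D,
      abs_div x, abs_of_pos hD]
    refine mul_le_mul_of_nonneg_left ?_ hδ
    exact mul_le_of_le_one_left (by positivity) ((div_le_one hD).mpr hx)
  have h2 : min 2 (m / D) ≤ 4 * (|D - E| / E) + 2 * (m / E) := by
    have hq : 0 ≤ |D - E| / E := by positivity
    have hq' : 0 ≤ m / E := by positivity
    -- Either `D` is comparable to `E`, or `|D - E|` is at least `E / 2` and already pays for the
    -- constant `2`.
    rcases le_total (E / 2) D with h | h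
    · refine (min_le_right _ _).trans ?_
      have : m / D ≤ m / (E / 2) := div_le_div_of_nonneg_left hm (by positivity) h
      have e : m / (E / 2) = 2 * (m / E) := by field_simp
      linarith
    · refine (min_le_left _ _).trans ?_
      have : 1 / 2 ≤ |D - E| / E := by
        rw [le_div_iff₀ hE, abs_sub_comm]
        refine le_trans ?_ (le_abs_self _)
        linarith
      linarith
  have h3 := mul_le_mul_of_nonneg_left h2 hδ
  have e : 5 * δ / E * |D - E| + 2 * δ * m / E =
      δ * (4 * (|D - E| / E) + 2 * (m / E)) + δ * (|D - E| / E) := by field_simp; ring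
  rw [e]
  exact add_le_add h3 h1

/-! ### Linear growth of the degree counts of a community -/

namespace CommunityModel

variable {r d : ℕ} [NeZero r] (A : CommunityModel r d)
variable (μ : Fin r → ℝ≥0) (hmean : ∀ t i, (A.X t).mean (fun x => (x i : ℝ≥0∞)) = μ i)

/-- The expected growth of the total weight of community `j` in a step. -/
def weightRate (j : Fin r) : ℝ := A.functionalRate μ 1 A.γ j

omit [NeZero r] in
theorem weightRate_eq (j : Fin r) :
    A.weightRate μ j = A.degreeRate μ j + A.γ * A.vertexRate j := by
  rw [weightRate, functionalRate, one_mul]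

omit [NeZero r] in
theorem functional_one_eq (γ : ℝ) (j : Fin r) (G : CommunityHypergraph r) :
    functional 1 γ j G = G.commWeight γ j := by
  rw [functional, CommunityHypergraph.commWeight, one_mul]

include hmean

theorem hasExpect_law_commDegree (t : ℕ) (j : Fin r) (k : ℕ) :
    (A.law t).HasExpect (commDegree j k) := by
  refine (A.hasExpect_law μ hmean t j).mono fun G _ => ?_
  obtain ⟨a, b⟩ := commSum_mem G j (indicatorAt_nonneg k) (indicatorAt_le_one k)
  change |G.commSum j (indicatorAt k)| ≤ _
  rw [abs_of_nonneg a]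
  have : (0 : ℝ) ≤ G.commVolume j := Nat.cast_nonneg _
  linarith

theorem hasExpect_law_prevWeight (t : ℕ) (j : Fin r) (k : ℕ) :
    (A.law t).HasExpect fun G => prevWeight A.γ j G k := by
  cases k with
  | zero => exact PMF.hasExpect_const _ 0
  | succ k => exact (A.hasExpect_law_commDegree μ hmean t j k).const_mul _

/-- Replacing the random weight by `weightRate * t` makes the rate equation linear, so that it
passes to expectations; the price is the mean deviation of the weight. -/
theorem abs_expect_law_succ_sub_le (hγ : 0 < A.γ) {t : ℕ} (ht : 1 ≤ t) (hs : A.SmallSizes t)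
    (j : Fin r) (k : ℕ) :
    |(A.law (t + 1)).expect (commDegree j k) - ((A.law t).expect (commDegree j k) +
      A.vertexRate j * indicatorAt k 0 + A.degreeRate μ j / (A.weightRate μ j * t) *
        (((A.law t).expect fun G => prevWeight A.γ j G k) -
          (k + A.γ) * (A.law t).expect (commDegree j k)))| ≤
    5 * A.degreeRate μ j / (A.weightRate μ j * t) * ((A.law t).expect fun G =>
      |functional 1 A.γ j G - A.weightRate μ j * t|) +
      2 * A.degreeRate μ j * ((t : ℝ) ^ (1 / 4 : ℝ) * (k + A.γ)) / (A.weightRate μ j * t) := by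
  have hγ' : (0 : ℝ) < A.γ := by exact_mod_cast hγ
  have ht0 : (0 : ℝ) < t := by exact_mod_cast ht
  have hδ := A.degreeRate_nonneg μ j
  have hκ : 0 < A.weightRate μ j := by
    rw [weightRate_eq]
    have := mul_pos hγ' (A.vertexRate_pos j)
    linarith
  set δ := A.degreeRate μ j
  set E := A.weightRate μ j * t with hE
  have hE0 : 0 < E := by positivity
  set m := (t : ℝ) ^ (1 / 4 : ℝ) * (k + A.γ) with hm
  have hm0 : 0 ≤ m := by positivity
  have hN := A.hasExpect_law_commDegree μ hmean t j k
  have hP := A.hasExpect_law_prevWeight μ hmean t j k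
  have hN1 := A.hasExpect_law_commDegree μ hmean (t + 1) j k
  have hW := (A.hasExpect_functional_sub μ hmean (c₁ := 1) (c₂ := A.γ) j t E).abs
  have hlin : (A.law t).HasExpect fun G => commDegree j k G + A.vertexRate j * indicatorAt k 0 +
      δ / E * (prevWeight A.γ j G k - (k + A.γ) * commDegree j k G) :=
    (hN.add (PMF.hasExpect_const _ _)).add ((hP.sub (hN.const_mul _)).const_mul _)
  have herr : (A.law t).HasExpect fun G => 5 * δ / E * |functional 1 A.γ j G - E| +
      2 * δ * m / E := (hW.const_mul _).add (PMF.hasExpect_const _ _)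
  have key : ∀ G ∈ (A.law t).support, |(A.step t G).expect (commDegree j k) -
      (commDegree j k G + A.vertexRate j * indicatorAt k 0 +
        δ / E * (prevWeight A.γ j G k - (k + A.γ) * commDegree j k G))| ≤
      5 * δ / E * |functional 1 A.γ j G - E| + 2 * δ * m / E := by
    intro G _
    have h1 := A.abs_expect_step_commDegree_sub_le μ hmean hs G j k
    rw [functional_one_eq]
    set D := G.commWeight A.γ j
    set x := prevWeight A.γ j G k - (k + A.γ) * commDegree j k G
    have hD : 0 < D := G.commWeight_pos hγ'.le j
    obtain ⟨p1, p2⟩ := prevWeight_mem hγ'.le j k G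
    obtain ⟨w1, w2⟩ := weight_mul_commDegree_mem hγ'.le j k G
    have hx : |x| ≤ D := abs_le.mpr ⟨by simp only [x, D]; linarith, by simp only [x, D]; linarith⟩
    refine le_trans ?_ (abs_div_weight_sub_le hD hE0 hx hm0 hδ)
    have e : (A.step t G).expect (commDegree j k) - (commDegree j k G +
        A.vertexRate j * indicatorAt k 0 + δ / E * x) =
        ((A.step t G).expect (commDegree j k) - (commDegree j k G +
          A.vertexRate j * indicatorAt k 0 + δ * (x / D))) + (δ * (x / D) - δ * (x / E)) := by
      ring
    rw [e]
    exact (abs_add_le _ _).trans (add_le_add_left h1 _)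
  have h := PMF.abs_expect_sub_le (A.hasExpect_law_succ hN1) hlin herr key
  rw [← A.expect_law_succ hN1, PMF.expect_add (hN.add (PMF.hasExpect_const _ _))
    ((hP.sub (hN.const_mul _)).const_mul _), PMF.expect_add hN (PMF.hasExpect_const _ _),
    PMF.expect_const, PMF.expect_const_mul, PMF.expect_sub hP (hN.const_mul _),
    PMF.expect_const_mul, PMF.expect_add (hW.const_mul _) (PMF.hasExpect_const _ _),
    PMF.expect_const_mul, PMF.expect_const] at h
  exact h

/-- The induction step over degrees: with the limiting inflow from the previous degree known,
`tendsto_div_of_recurrence` applies with `b = θ (k + γ)`, where `θ = degreeRate / weightRate`. -/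
theorem tendsto_expect_commDegree_of_prevWeight (hγ : 0 < A.γ)
    (hs : ∀ᶠ t in atTop, A.SmallSizes t) (j : Fin r) (k : ℕ) {l : ℝ}
    (hl : Tendsto (fun t : ℕ => ((A.law t).expect fun G => prevWeight A.γ j G k) / t)
      atTop (𝓝 l)) :
    Tendsto (fun t : ℕ => (A.law t).expect (commDegree j k) / t) atTop
      (𝓝 ((A.vertexRate j * indicatorAt k 0 + A.degreeRate μ j / A.weightRate μ j * l) /
        (1 + A.degreeRate μ j / A.weightRate μ j * (k + A.γ)))) := by
  have hγ' : (0 : ℝ) < A.γ := by exact_mod_cast hγ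
  have hδ := A.degreeRate_nonneg μ j
  have hκ : 0 < A.weightRate μ j := by
    rw [weightRate_eq]
    have := mul_pos hγ' (A.vertexRate_pos j)
    linarith
  set κ := A.weightRate μ j
  set δ := A.degreeRate μ j
  set v := A.vertexRate j * indicatorAt k 0
  let err : ℕ → ℝ := fun t => 5 * δ / (κ * t) * ((A.law t).expect fun G =>
      |functional 1 A.γ j G - κ * t|) + 2 * δ * ((t : ℝ) ^ (1 / 4 : ℝ) * (k + A.γ)) / (κ * t)
  let P : ℕ → ℝ := fun t => (A.law t).expect fun G => prevWeight A.γ j G k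
  have herr : Tendsto err atTop (𝓝 0) := by
    have h1 := (A.tendsto_expect_abs_functional_sub μ hmean zero_le_one hγ'.le j hs).const_mul
      (5 * δ / κ)
    have h2 : Tendsto (fun t : ℕ => (t : ℝ) ^ (-(3 / 4) : ℝ)) atTop (𝓝 0) :=
      (tendsto_rpow_neg_atTop (by norm_num)).comp tendsto_natCast_atTop_atTop
    have h3 := h1.add (h2.const_mul (2 * δ * (k + A.γ) / κ))
    rw [mul_zero, mul_zero, add_zero] at h3
    refine h3.congr' ?_
    filter_upwards [eventually_ge_atTop 1] with t ht
    have ht0 : (0 : ℝ) < t := by exact_mod_cast ht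
    have e : (t : ℝ) ^ (1 / 4 : ℝ) = t * (t : ℝ) ^ (-(3 / 4) : ℝ) := by
      nth_rewrite 2 [← Real.rpow_one (t : ℝ)]
      rw [← Real.rpow_add ht0]
      norm_num
    simp only [err]
    rw [e]
    change 5 * δ / κ * (((A.law t).expect fun G => |functional 1 A.γ j G - κ * t|) / t) + _ = _
    field_simp
  -- The inflow is replaced by its limit `l`, the difference being absorbed in the error, so that
  -- the recurrence has a constant source.
  have hl' : Tendsto (fun t : ℕ => err t + δ / κ * |P t / t - l|) atTop (𝓝 0) := by
    have h1 : Tendsto (fun t : ℕ => |P t / t - l|) atTop (𝓝 0) := by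
      simpa using (hl.sub_const l).abs
    simpa using herr.add (h1.const_mul (δ / κ))
  refine tendsto_div_of_recurrence (by positivity) hl' ?_
  filter_upwards [hs, eventually_ge_atTop 1] with t hst ht
  have ht0 : (0 : ℝ) < t := by exact_mod_cast ht
  have h := A.abs_expect_law_succ_sub_le μ hmean hγ ht hst j k
  set a := (A.law t).expect (commDegree j k)
  have e : (A.law (t + 1)).expect (commDegree j k) -
      ((1 - δ / κ * (k + A.γ) / t) * a + (v + δ / κ * l)) =
      ((A.law (t + 1)).expect (commDegree j k) - (a + v + δ / (κ * t) *
        (P t - (k + A.γ) * a))) + δ / κ * (P t / t - l) := by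
    field_simp
    ring
  rw [e]
  refine (abs_add_le _ _).trans (add_le_add h (le_of_eq ?_))
  rw [abs_mul, abs_of_nonneg (by positivity)]

/-- The number of vertices of degree `k` in community `j` grows linearly in mean. -/
theorem tendsto_expect_commDegree (hγ : 0 < A.γ) (hs : ∀ᶠ t in atTop, A.SmallSizes t)
    (j : Fin r) (k : ℕ) :
    Tendsto (fun t : ℕ => (A.law t).expect (commDegree j k) / t) atTop
      (𝓝 (degreeLimit (A.vertexRate j) (A.degreeRate μ j / A.weightRate μ j) A.γ k)) := by
  induction k with
  | zero =>
    have h := A.tendsto_expect_commDegree_of_prevWeight μ hmean hγ hs j 0 (l := 0) (by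
      simp [prevWeight, PMF.expect_const])
    simpa [indicatorAt, degreeLimit] using h
  | succ k ih =>
    have h := A.tendsto_expect_commDegree_of_prevWeight μ hmean hγ hs j (k + 1)
      (l := (k + A.γ) * degreeLimit (A.vertexRate j) (A.degreeRate μ j / A.weightRate μ j) A.γ k)
      (by
        simp only [prevWeight, PMF.expect_const_mul, mul_div_assoc]
        exact ih.const_mul _)
    simpa [indicatorAt, degreeLimit] using h

end CommunityModel

/-! ### Limiting degree distribution of the whole hypergraph -/

namespace CommunityModel

variable {r d : ℕ} [NeZero r] (A : CommunityModel r d)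

theorem _root_.CommunityHypergraph.size_pos (G : CommunityHypergraph r) : 0 < G.size := by
  obtain ⟨v, -⟩ := G.covered 0
  exact v.pos

omit [NeZero r] in
theorem _root_.CommunityHypergraph.numDegree_le_size (G : CommunityHypergraph r) (k : ℕ) :
    G.numDegree k ≤ G.size :=
  (Finset.card_filter_le _ _).trans (by simp)

omit [NeZero r] in
theorem numDegree_eq_sum_commDegree (G : CommunityHypergraph r) (k : ℕ) :
    (G.numDegree k : ℝ) = ∑ j, commDegree j k G := by
  rw [G.numDegree_eq_sum, Nat.cast_sum]
  refine Finset.sum_congr rfl fun j _ => ?_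
  simp only [CommunityHypergraph.commSum, commDegree, indicatorAt, Nat.cast_sum, Nat.cast_ite,
    Nat.cast_one, Nat.cast_zero]

theorem meanDegreeFraction_eq_expect (t k : ℕ) :
    A.meanDegreeFraction t k = (A.law t).expect fun G => (G.numDegree k : ℝ) / G.size := by
  rw [PMF.expect_of_nonneg _ fun G => by positivity, meanDegreeFraction]
  congr 2
  funext G
  rw [ENNReal.ofReal_div_of_pos (by exact_mod_cast G.size_pos), ENNReal.ofReal_natCast,
    ENNReal.ofReal_natCast]

omit [NeZero r] in
theorem sum_vertexRate : ∑ j, A.vertexRate j = A.p := by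
  have h := PMF.expect_const A.M 1
  rw [PMF.expect_fintype] at h
  simp only [mul_one] at h
  simp only [vertexRate, ← Finset.mul_sum, h, mul_one]

section Limit

variable (μ : Fin r → ℝ≥0) (hmean : ∀ t i, (A.X t).mean (fun x => (x i : ℝ≥0∞)) = μ i)

/-- The limiting fraction of vertices of degree `k`. -/
def limitFraction (k : ℕ) : ℝ :=
  (∑ j, degreeLimit (A.vertexRate j) (A.degreeRate μ j / A.weightRate μ j) A.γ k) / A.p

include hmean

/-- The random denominator is replaced by `p t`. Since `N ≤ |V|`, this changes the fraction by at
most `||V| - p t| / (p t)`, which tends to zero in mean by the law of large numbers for sizes, the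
coefficients being `0` and `1`. -/
theorem tendsto_meanDegreeFraction (hγ : 0 < A.γ) (hs : ∀ᶠ t in atTop, A.SmallSizes t) (k : ℕ) :
    Tendsto (fun t => A.meanDegreeFraction t k) atTop (𝓝 (A.limitFraction μ k)) := by
  have hp : (0 : ℝ) < A.p := by exact_mod_cast A.p_pos
  let dev : Fin r → CommunityHypergraph r → ℕ → ℝ := fun j G t =>
    functional 0 1 j G - A.functionalRate μ 0 1 j * t
  have hdev : ∀ t j, (A.law t).HasExpect fun G => |dev j G t| := fun t j =>
    (A.hasExpect_functional_sub μ hmean j t _).abs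
  have hsize : ∀ (G : CommunityHypergraph r) (t : ℕ), (G.size : ℝ) - A.p * t = ∑ j, dev j G t := by
    intro G t
    simp only [dev, functional, functionalRate, zero_mul, zero_add, one_mul]
    rw [Finset.sum_sub_distrib, ← Finset.sum_mul, A.sum_vertexRate, G.size_eq_sum, Nat.cast_sum]
  have hmain : Tendsto (fun t : ℕ => (∑ j, (A.law t).expect (commDegree j k) / t) / A.p) atTop
      (𝓝 (A.limitFraction μ k)) :=
    (tendsto_finsetSum _ fun j _ => A.tendsto_expect_commDegree μ hmean hγ hs j k).div_const _
  have herr : Tendsto (fun t : ℕ => (∑ j, ((A.law t).expect fun G => |dev j G t|) / t) / A.p) atTop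
      (𝓝 0) := by
    have h := (tendsto_finsetSum (Finset.univ : Finset (Fin r)) fun j _ =>
      A.tendsto_expect_abs_functional_sub μ hmean le_rfl zero_le_one j hs).div_const (A.p : ℝ)
    simpa using h
  have hdiff : Tendsto (fun t : ℕ => A.meanDegreeFraction t k -
      (∑ j, (A.law t).expect (commDegree j k) / t) / A.p) atTop (𝓝 0) := by
    rw [tendsto_zero_iff_abs_tendsto_zero]
    refine squeeze_zero' (Eventually.of_forall fun t => abs_nonneg _) ?_ herr
    filter_upwards [eventually_ge_atTop 1] with t ht
    have ht0 : (0 : ℝ) < t := by exact_mod_cast ht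
    have hN : (A.law t).HasExpect fun G => ∑ j, commDegree j k G :=
      PMF.HasExpect.sum _ fun j _ => A.hasExpect_law_commDegree μ hmean t j k
    have e1 : (∑ j, (A.law t).expect (commDegree j k) / t) / A.p =
        (A.law t).expect fun G => (A.p * (t : ℝ))⁻¹ * ∑ j, commDegree j k G := by
      rw [PMF.expect_const_mul, PMF.expect_sum _ fun j _ =>
        A.hasExpect_law_commDegree μ hmean t j k, ← Finset.sum_div]
      field_simp
    have e2 : (∑ j, ((A.law t).expect fun G => |dev j G t|) / t) / A.p =
        (A.law t).expect fun G => (A.p * (t : ℝ))⁻¹ * ∑ j, |dev j G t| := by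
      rw [PMF.expect_const_mul, PMF.expect_sum _ fun j _ => hdev t j, ← Finset.sum_div]
      field_simp
    simp only [Function.comp_apply]
    rw [e1, e2, meanDegreeFraction_eq_expect]
    have hle : ∀ G : CommunityHypergraph r, (G.numDegree k : ℝ) / G.size ≤ 1 := fun G => by
      rw [div_le_one (by exact_mod_cast G.size_pos)]
      exact_mod_cast G.numDegree_le_size k
    refine PMF.abs_expect_sub_le (PMF.hasExpect_of_bounded 1 fun G _ => ?_) (hN.const_mul _)
      ((PMF.HasExpect.sum _ fun j _ => hdev t j).const_mul _) fun G _ => ?_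
    · rw [abs_of_nonneg (by positivity)]
      exact hle G
    · rw [← numDegree_eq_sum_commDegree]
      have hsz : (0 : ℝ) < G.size := by exact_mod_cast G.size_pos
      have e : (G.numDegree k : ℝ) / G.size - (A.p * (t : ℝ))⁻¹ * G.numDegree k =
          -((G.numDegree k : ℝ) / G.size * ((A.p * (t : ℝ))⁻¹ * (G.size - A.p * t))) := by
        field_simp
        ring
      rw [e, abs_neg, abs_mul, abs_of_nonneg (by positivity : (0 : ℝ) ≤ G.numDegree k / G.size),
        abs_mul, abs_of_nonneg (by positivity : (0 : ℝ) ≤ (A.p * (t : ℝ))⁻¹), hsize]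
      refine (mul_le_of_le_one_left (by positivity) (hle G)).trans ?_
      exact mul_le_mul_of_nonneg_left (Finset.abs_sum_le_sum_abs _ _) (by positivity)
  simpa using hdiff.add hmain

end Limit

/-! ### The power law: the slowest decay wins -/

omit [NeZero r] in
-- As `d ≥ 1`, no index lists the empty set, so a new hyperedge always selects some community.
theorem exists_share_ne_zero (hd : 0 < d) : ∃ j, A.P.share j ≠ 0 := by
  by_contra! h
  have h0 : ∀ S, A.P.toPMF S = 0 := by
    intro S
    rcases S.eq_empty_or_nonempty with rfl | ⟨j, hj⟩
    · change A.P.setProb ∅ = 0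
      rw [HyperedgeMatrix.setProb]
      simp only [ENNReal.iSup_eq_zero]
      intro a ha
      have := Finset.mem_image_of_mem a (Finset.mem_univ (⟨0, hd⟩ : Fin d))
      rw [ha] at this
      simp at this
    · have := h j
      rw [HyperedgeMatrix.share, Finset.sum_eq_zero_iff] at this
      exact this S (by simpa using hj)
  have := A.P.toPMF.tsum_coe
  simp [h0] at this

/-- A finite sum of sequences with power-law decay decays like its slowest term. -/
theorem exists_tendsto_sum_mul_rpow {ι : Type} [Fintype ι] {u : ι → ℕ → ℝ} {β : ℝ}
    (h : ∀ i, ∃ C : ℝ, 0 ≤ C ∧ Tendsto (fun k : ℕ => u i k * (k : ℝ) ^ β) atTop (𝓝 C))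
    (h' : ∃ i, ∃ C : ℝ, 0 < C ∧ Tendsto (fun k : ℕ => u i k * (k : ℝ) ^ β) atTop (𝓝 C)) :
    ∃ C : ℝ, 0 < C ∧ Tendsto (fun k : ℕ => (∑ i, u i k) * (k : ℝ) ^ β) atTop (𝓝 C) := by
  choose C hC hlim using h
  obtain ⟨i, c, hc, hi⟩ := h'
  refine ⟨∑ i, C i, Finset.sum_pos' (fun i _ => hC i) ⟨i, Finset.mem_univ i, ?_⟩, ?_⟩
  · rwa [tendsto_nhds_unique (hlim i) hi]
  · simp only [Finset.sum_mul]
    exact tendsto_finsetSum _ fun i _ => hlim i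

theorem tendsto_mul_rpow_zero_of_lt {u : ℕ → ℝ} {β β' C : ℝ} (hβ : β < β')
    (h : Tendsto (fun k : ℕ => u k * (k : ℝ) ^ β') atTop (𝓝 C)) :
    Tendsto (fun k : ℕ => u k * (k : ℝ) ^ β) atTop (𝓝 0) := by
  have h1 : Tendsto (fun k : ℕ => (k : ℝ) ^ (-(β' - β))) atTop (𝓝 0) :=
    (tendsto_rpow_neg_atTop (by linarith)).comp tendsto_natCast_atTop_atTop
  have h2 := h.mul h1
  rw [mul_zero] at h2
  refine h2.congr' ?_
  filter_upwards [eventually_ge_atTop 1] with k hk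
  have hk0 : (0 : ℝ) < k := by exact_mod_cast hk
  rw [mul_assoc, ← Real.rpow_add hk0]
  congr 2
  ring

section PowerLaw

variable (μ : Fin r → ℝ≥0)

omit [NeZero r] in
-- The exponent is `1 + 1/θ` with `1/θ = weightRate / degreeRate = 1 + γ * vertexRate / degreeRate`.
theorem exists_tendsto_commLimit (hγ : 0 < A.γ) {j : Fin r} (hj : 0 < A.degreeRate μ j) :
    ∃ C : ℝ, 0 < C ∧ Tendsto (fun k : ℕ =>
      degreeLimit (A.vertexRate j) (A.degreeRate μ j / A.weightRate μ j) A.γ k *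
        (k : ℝ) ^ (2 + A.γ * (A.vertexRate j / A.degreeRate μ j))) atTop (𝓝 C) := by
  have hγ' : (0 : ℝ) < A.γ := by exact_mod_cast hγ
  have hv := A.vertexRate_pos j
  have hκ : 0 < A.weightRate μ j := by
    rw [weightRate_eq]
    positivity
  obtain ⟨C, hC, h⟩ := exists_tendsto_degreeLimit hv (div_pos hj hκ) hγ'
  refine ⟨C, hC, ?_⟩
  have e : 2 + A.γ * (A.vertexRate j / A.degreeRate μ j) =
      1 + 1 / (A.degreeRate μ j / A.weightRate μ j) := by
    rw [weightRate_eq]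
    field_simp
    ring
  rw [e]
  exact h

/-- The power law, for an exponent that is minimal among those of the communities. -/
theorem followsPowerLaw_of_min
    (hmean : ∀ t i, (A.X t).mean (fun x => (x i : ℝ≥0∞)) = μ i) (hγ : 0 < A.γ)
    (hs : ∀ᶠ t in atTop, A.SmallSizes t) {j₀ : Fin r} (hj₀ : 0 < A.degreeRate μ j₀)
    (hmin : ∀ j, 0 < A.degreeRate μ j →
      A.vertexRate j₀ / A.degreeRate μ j₀ ≤ A.vertexRate j / A.degreeRate μ j) :
    A.FollowsPowerLaw (2 + A.γ * (A.vertexRate j₀ / A.degreeRate μ j₀)) := by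
  have hγ' : (0 : ℝ) < A.γ := by exact_mod_cast hγ
  have hp : (0 : ℝ) < A.p := by exact_mod_cast A.p_pos
  have hv := A.vertexRate_pos j₀
  set β := 2 + A.γ * (A.vertexRate j₀ / A.degreeRate μ j₀) with hβ
  refine ⟨?_, A.limitFraction μ, A.tendsto_meanDegreeFraction μ hmean hγ hs, ?_⟩
  · have : 0 ≤ A.γ * (A.vertexRate j₀ / A.degreeRate μ j₀) := by positivity
    linarith
  obtain ⟨C, hC, h⟩ := exists_tendsto_sum_mul_rpow (β := β) (u := fun (j : Fin r) k =>
      degreeLimit (A.vertexRate j) (A.degreeRate μ j / A.weightRate μ j) A.γ k)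
    (fun j => by
      -- A community with zero degree rate contributes only at degree zero; one with a ratio above
      -- the minimum decays strictly faster. Both have the limit constant `0`.
      rcases (A.degreeRate_nonneg μ j).eq_or_lt with hj | hj
      · refine ⟨0, le_rfl, tendsto_const_nhds.congr' ?_⟩
        filter_upwards [eventually_ge_atTop 1] with k hk
        obtain ⟨k, rfl⟩ := Nat.exists_eq_add_of_le' hk
        rw [← hj, zero_div, degreeLimit_zero_succ, zero_mul]
      · obtain ⟨C, hC, h⟩ := A.exists_tendsto_commLimit μ hγ hj
        rcases (hmin j hj).eq_or_lt with he | hlt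
        · exact ⟨C, hC.le, by rw [hβ, he]; exact h⟩
        · refine ⟨0, le_rfl, tendsto_mul_rpow_zero_of_lt ?_ h⟩
          rw [hβ]
          have := mul_lt_mul_of_pos_left hlt hγ'
          linarith)
    ⟨j₀, A.exists_tendsto_commLimit μ hγ hj₀⟩
  refine ⟨C / A.p, by positivity, ?_⟩
  have h2 := h.div_const C
  rw [div_self hC.ne'] at h2
  refine h2.congr' ?_
  filter_upwards [eventually_ge_atTop 1] with k hk
  have hk0 : (0 : ℝ) < k := by exact_mod_cast hk
  have hkβ : 0 < (k : ℝ) ^ β := by positivity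
  rw [limitFraction, Real.rpow_neg hk0.le]
  field_simp

end PowerLaw

end CommunityModel

end

/-! ### Identification of the exponent -/

theorem theorem2 {r d : ℕ} [NeZero r] (hd : 0 < d) (A : CommunityModel r d) (hγ : 0 < A.γ)
    (μ : Fin r → ℝ≥0)
    (hmean : ∀ t i, (A.X t).mean (fun x => (x i : ℝ≥0∞)) = μ i)
    (hone : ∀ t, ∀ x ∈ (A.X t).support, ∀ i, 1 ≤ x i)
    (hbound : ∀ᶠ t : ℕ in atTop, ∀ x ∈ (A.X t).support, ∀ i,
      (x i : ℝ) < (t : ℝ) ^ (1 / 4 : ℝ)) :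
    (∀ t j, A.meanNewVertices t j = A.p * A.M j) ∧
    (∀ t j, A.meanDegreeIncrease t j
      = (1 - A.p) * A.P.share j * ((∑ i, (μ i : ℝ≥0∞)) / r)) ∧
    ∃ β : ℝ,
      (∀ t, β = 2 + A.γ * (⨅ j, A.meanNewVertices t j / A.meanDegreeIncrease t j).toReal) ∧
      β = 2 + A.γ * A.p / ((1 - A.p) * ((∑ i, (μ i : ℝ)) / r)) *
        (⨅ j, A.M j / A.P.share j).toReal ∧
      A.FollowsPowerLaw β := by
  have hV : ∀ t j, A.meanNewVertices t j = A.p * A.M j := fun t j => by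
    rw [A.meanNewVertices_eq_increment, A.increment_mean_fst]
  have hD : ∀ t j, A.meanDegreeIncrease t j
      = (1 - A.p) * A.P.share j * ((∑ i, (μ i : ℝ≥0∞)) / r) := fun t j => by
    rw [A.meanDegreeIncrease_eq_increment, A.increment_mean_snd μ hmean]
  -- Sizes of at least one make the mean size `m` nonzero, hence the constant `K` below finite.
  have hμ : ∀ i, (1 : ℝ≥0∞) ≤ μ i := fun i => by
    rw [← hmean 0 i, ← PMF.mean_const (A.X 0) 1]
    exact PMF.mean_mono fun x hx => by exact_mod_cast hone 0 x hx i
  have hp0 : (A.p : ℝ≥0∞) ≠ 0 := by exact_mod_cast A.p_pos.ne'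
  have hp1 : (1 - A.p : ℝ≥0∞) ≠ 0 := (tsub_pos_of_lt (by exact_mod_cast A.p_lt_one)).ne'
  have hp1' : (1 - A.p : ℝ≥0∞) ≠ ∞ := ne_top_of_le_ne_top ENNReal.one_ne_top tsub_le_self
  set m : ℝ≥0∞ := (∑ i, (μ i : ℝ≥0∞)) / r with hm
  have hm0 : m ≠ 0 := by
    refine ENNReal.div_ne_zero.mpr ⟨fun h => ?_, ENNReal.natCast_ne_top r⟩
    have h0 := (Finset.sum_eq_zero_iff.mp h) 0 (Finset.mem_univ _)
    have := hμ 0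
    rw [h0] at this
    simp at this
  have hm1 : m ≠ ∞ := ENNReal.div_ne_top (ENNReal.sum_lt_top.mpr fun i _ => ENNReal.coe_lt_top).ne
    (by exact_mod_cast NeZero.ne r)
  have hmR : m.toReal = (∑ i, (μ i : ℝ)) / r := by
    rw [hm, ENNReal.toReal_div, ENNReal.toReal_sum fun i _ => ENNReal.coe_ne_top]
    rfl
  have hmR0 : 0 < m.toReal := ENNReal.toReal_pos hm0 hm1
  -- The factor common to the ratios of all communities. Being neither `0` nor `∞`, it can be pulled
  -- out of the infimum.
  set K : ℝ≥0∞ := A.p / ((1 - A.p) * m) with hK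
  have hK0 : K ≠ 0 := ENNReal.div_ne_zero.mpr ⟨hp0, ENNReal.mul_ne_top hp1' hm1⟩
  have hK1 : K ≠ ∞ := ENNReal.div_ne_top ENNReal.coe_ne_top (mul_ne_zero hp1 hm0)
  have hKR : K.toReal = A.p / ((1 - A.p) * ((∑ i, (μ i : ℝ)) / r)) := by
    rw [hK, ENNReal.toReal_div, ENNReal.toReal_mul, hmR, ENNReal.toReal_sub_of_le
      (by exact_mod_cast A.p_lt_one.le) ENNReal.one_ne_top]
    rfl
  have hratio : ∀ t j, A.meanNewVertices t j / A.meanDegreeIncrease t j =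
      K * (A.M j / A.P.share j) := fun t j => by
    rw [hV, hD, mul_right_comm, hK]
    simp only [div_eq_mul_inv]
    rw [ENNReal.mul_inv (Or.inl (mul_ne_zero hp1 hm0)) (Or.inl (ENNReal.mul_ne_top hp1' hm1))]
    ring
  have hinf : ∀ t, (⨅ j, A.meanNewVertices t j / A.meanDegreeIncrease t j) =
      K * ⨅ j, A.M j / A.P.share j := fun t => by
    simp only [hratio t]
    rw [ENNReal.mul_iInf_of_ne hK0 hK1]
  obtain ⟨j₀, hj₀⟩ := exists_eq_ciInf_of_finite (f := fun j => A.M j / A.P.share j)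
  -- Some community has a finite ratio, so the minimum is finite and the minimiser has a positive
  -- share; thus `toReal` does not turn an infinite minimum into `0`.
  have hshare : A.P.share j₀ ≠ 0 := by
    obtain ⟨i, hi⟩ := A.exists_share_ne_zero hd
    intro h0
    have hle : A.M j₀ / A.P.share j₀ ≤ A.M i / A.P.share i := by
      rw [hj₀]
      exact iInf_le _ i
    rw [h0, ENNReal.div_zero (A.M_pos j₀).ne', top_le_iff] at hle
    exact ENNReal.div_ne_top (A.M.apply_ne_top i) hi hle
  have hrate : ∀ j, A.degreeRate μ j = (1 - A.p) * (A.P.share j).toReal * m.toReal := fun j => by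
    rw [hmR, CommunityModel.degreeRate]
  have hpR : (0 : ℝ) < 1 - A.p := by linarith [A.p_real_lt_one]
  have hquot : ∀ j, A.vertexRate j / A.degreeRate μ j = (K * (A.M j / A.P.share j)).toReal :=
    fun j => by
      rw [← hratio 0 j, hV, hD, ENNReal.toReal_div, A.toReal_degreeRate μ j, ENNReal.toReal_mul]
      rfl
  have hpos : 0 < A.degreeRate μ j₀ := by
    rw [hrate]
    have := ENNReal.toReal_pos hshare (A.share_ne_top j₀)
    positivity
  refine ⟨hV, hD, 2 + A.γ * (A.vertexRate j₀ / A.degreeRate μ j₀), fun t => ?_, ?_, ?_⟩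
  · rw [hinf, hquot, hj₀]
  · rw [hquot, hj₀, ENNReal.toReal_mul, hKR]
    ring
  · refine A.followsPowerLaw_of_min μ hmean hγ hbound hpos fun j hj => ?_
    have hsj : A.P.share j ≠ 0 := fun h0 => by
      rw [hrate, h0] at hj
      simp at hj
    rw [hquot, hquot]
    refine ENNReal.toReal_mono
      (ENNReal.mul_ne_top hK1 (ENNReal.div_ne_top (A.M.apply_ne_top j) hsj)) ?_
    rw [hj₀]
    exact mul_le_mul_right (iInf_le _ j) K
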